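/- Let $n\ge 2$ and $\varepsilon>0$. Let $M=\mathbb{C}^n/2\pi\mathbb{Z}^n$ with the flat metric induced from $\mathbb{C}^n$ (for which the $\partial/\partial x_j,\partial/\partial y_j$, $z=x+iy$, are orthonormal), and let $X=\{[z]\in M:\ |\operatorname{Im} z|=\varepsilon\}$, a compact CR manifold with $T^{1,0}X=T^{1,0}M\cap\mathbb{C}TX$, equipped with the induced metric and volume form. Let $H^0_b(X)=\operatorname{Ker}\Box_b\subset L^2(X)$ be the space of square integrable CR functions, where $\Box_b=\overline\partial_b^{*}\overline\partial_b$ is the Kohn Laplacian on functions; here $\overline\partial_b$ is extended to $\operatorname{Dom}\overline\partial_b=\{u\in L^2(X):\overline\partial_b u\in L^2_{(0,1)}(X)\}$ in the sense of distributions and $\overline\partial_b^{*}$ is its $L^2$-adjoint. Let $\Pi:L^2(X)\to H^0_b(X)$ be the orthogonal (Szegő) projection, let $T=\sum_{j=1}^n y_j\,\partial/\partial x_j$ acting on $\mathscr{C}^\infty(X)$, and let $A=\Pi\,\frac{i}{\varepsilon}T\,\Pi$, defined on all $u\in L^2(X)$ with $\Pi u\in\mathscr{C}^\infty(X)$. For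 $t\in\mathbb{R}$ put $$\gamma_n(t)=\int_0^\pi e^{t\cos\alpha}\sin^{n-2}\alpha\,d\alpha,$$ and for $m\in\mathbb{Z}^n$ define $s_m:X\to\mathbb{C}$ by $$s_m([z])=\frac{e^{i\langle m,z\rangle}}{(2\pi)^{n/2}\sqrt{\varepsilon^{n-1}\,\gamma_n(2\varepsilon|m|)\,\operatorname{vol}(S^{n-2})}},\qquad \langle m,z\rangle=\sum_{j=1}^n m_jz_j,$$ where $|m|$ is the Euclidean length of $m$ and $\operatorname{vol}(S^{n-2})$ is the surface measure of the unit sphere in $\mathbb{R}^{n-1}$ (so $\operatorname{vol}(S^0)=2$). Then $\{s_m\}_{m\in\mathbb{Z}^n}$ is an orthonormal (Hilbert) basis of $H^0_b(X)$, and for every $m\in\mathbb{Z}^n$ the function $s_m$ lies in the domain of $A$ and $$A s_m=|m|\,\frac{\gamma_n'(2\varepsilon|m|)}{\gamma_n(2\varepsilon|m|)}\,s_m .$$ -/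

import Mathlib

noncomputable section

namespace GrauertTube

open MeasureTheory
open scoped ContDiff

/-! ### The complex manifold `M = ℂⁿ / 2πℤⁿ` and the hypersurface `X = {|Im z| = ε}` -/

/-- The lattice `2πℤⁿ ⊂ ℝⁿ ⊂ ℂⁿ`. -/
def lattice (n : ℕ) : AddSubgroup (EuclideanSpace ℂ (Fin n)) where
  carrier := {z | ∃ k : Fin n → ℤ, ∀ j, z j = 2 * (Real.pi : ℂ) * (k j : ℂ)}
  zero_mem' := ⟨0, by simp⟩
  add_mem' := by
    rintro a b ⟨k, hk⟩ ⟨l, hl⟩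
    exact ⟨k + l, fun j => by simp [hk j, hl j]; ring⟩
  neg_mem' := by
    rintro a ⟨k, hk⟩
    exact ⟨-k, fun j => by simp [hk j]⟩

/-- The complex manifold `M = ℂⁿ / 2πℤⁿ`. -/
abbrev TorusC (n : ℕ) : Type := EuclideanSpace ℂ (Fin n) ⧸ lattice n

/-- The point `x + i y` of `ℂⁿ`. -/
def ofReIm {n : ℕ} (x y : EuclideanSpace ℝ (Fin n)) : EuclideanSpace ℂ (Fin n) :=
  WithLp.toLp 2 fun j => (x j : ℂ) + Complex.I * (y j : ℂ)

/-- The vector `x = Re z` of `ℝⁿ`. -/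
def rePart {n : ℕ} (z : EuclideanSpace ℂ (Fin n)) : EuclideanSpace ℝ (Fin n) :=
  WithLp.toLp 2 fun j => (z j).re

/-- The vector `y = Im z` of `ℝⁿ`. -/
def imPart {n : ℕ} (z : EuclideanSpace ℂ (Fin n)) : EuclideanSpace ℝ (Fin n) :=
  WithLp.toLp 2 fun j => (z j).im

theorem imPart_ofReIm {n : ℕ} (x y : EuclideanSpace ℝ (Fin n)) : imPart (ofReIm x y) = y := by
  ext j; simp [imPart, ofReIm]

theorem imPart_add_lattice {n : ℕ} (z : EuclideanSpace ℂ (Fin n))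
    {l : EuclideanSpace ℂ (Fin n)} (hl : l ∈ lattice n) : imPart (z + l) = imPart z := by
  obtain ⟨k, hk⟩ := hl
  ext j
  simp [imPart, hk j]

/-- The function `[z] ↦ Im z` on `M`. -/
def imM {n : ℕ} : TorusC n → EuclideanSpace ℝ (Fin n) :=
  Quotient.lift imPart (by
    intro a b hab
    have h : -a + b ∈ lattice n := QuotientAddGroup.leftRel_apply.mp hab
    have := imPart_add_lattice a h
    rw [← this]; congr 1; abel)

@[simp] theorem imM_mk {n : ℕ} (z : EuclideanSpace ℂ (Fin n)) :
    imM (QuotientAddGroup.mk z : TorusC n) = imPart z := rfl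

/-- The hypersurface `X = {[z] ∈ M : |Im z| = ε}`, with the subspace topology and its
Borel `σ`-algebra. -/
def X (n : ℕ) (ε : ℝ) : Type := {p : TorusC n // ‖imM p‖ = ε}

instance (n : ℕ) (ε : ℝ) : TopologicalSpace (X n ε) :=
  inferInstanceAs (TopologicalSpace {p : TorusC n // ‖imM p‖ = ε})

instance (n : ℕ) (ε : ℝ) : MeasurableSpace (X n ε) := borel _

instance (n : ℕ) (ε : ℝ) : BorelSpace (X n ε) := ⟨rfl⟩

variable {n : ℕ} {ε : ℝ}

/-- A representative in `ℂⁿ` of a point of `X`. Everything below that is defined with it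
is invariant under the lattice. -/
def rep (p : X n ε) : EuclideanSpace ℂ (Fin n) := Quotient.out p.1

theorem norm_imPart_rep (p : X n ε) : ‖imPart (rep p)‖ = ε := by
  have h : (QuotientAddGroup.mk (rep p) : TorusC n) = p.1 := Quotient.out_eq p.1
  rw [← imM_mk, h]; exact p.2

/-- The point `[x + i ε w]` of `X`, for `x ∈ ℝⁿ` and a unit vector `w`. -/
def param [hε : Fact (0 < ε)] (x w : EuclideanSpace ℝ (Fin n)) (hw : ‖w‖ = 1) : X n ε :=
  ⟨QuotientAddGroup.mk (ofReIm x (ε • w)), by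
    rw [imM_mk, imPart_ofReIm, norm_smul, hw, mul_one, Real.norm_of_nonneg hε.out.le]⟩

/-- The volume measure on `X` induced by the flat metric of `M`. Through
`(x, w) ↦ [x + i ε w]` with `x` in the box `[0, 2π)ⁿ` and `w` in the unit sphere, it is Lebesgue
measure in `x` times `ε ^ (n - 1)` times the surface measure of the unit sphere. -/
def vol (n : ℕ) (ε : ℝ) [Fact (0 < ε)] : Measure (X n ε) :=
  ENNReal.ofReal (ε ^ (n - 1)) •
    Measure.map
      (fun q : EuclideanSpace ℝ (Fin n) × Metric.sphere (0 : EuclideanSpace ℝ (Fin n)) 1 =>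
        param q.1 (q.2 : EuclideanSpace ℝ (Fin n)) (by simp))
      (((volume : Measure (EuclideanSpace ℝ (Fin n))).restrict
          {x | ∀ j, x j ∈ Set.Ico (0 : ℝ) (2 * Real.pi)}).prod
        (volume : Measure (EuclideanSpace ℝ (Fin n))).toSphere)

/-! ### Smooth functions and their derivatives along `X` -/

section Smooth

variable {V : Type*} [NormedAddCommGroup V] [NormedSpace ℝ V]

set_option linter.unusedSectionVars false

open Classical in
/-- The extension of `f : X → V` to `{z ∈ ℂⁿ : Im z ≠ 0}` by means of the smooth retraction
`x + i y ↦ [x + i ε y / |y|]` onto `X`. -/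
def ext [Fact (0 < ε)] (f : X n ε → V) (z : EuclideanSpace ℂ (Fin n)) : V :=
  if h : imPart z = 0 then 0
  else f (param (rePart z) (‖imPart z‖⁻¹ • imPart z) (by
    rw [norm_smul, norm_inv, norm_norm, inv_mul_cancel₀ (norm_ne_zero_iff.mpr h)]))

/-- `f : X → V` is smooth. -/
def IsSmooth [Fact (0 < ε)] (f : X n ε → V) : Prop :=
  ∀ z : EuclideanSpace ℂ (Fin n), imPart z ≠ 0 → ContDiffAt ℝ ∞ (ext f) z

/-- The derivative of `f` at `p ∈ X` in direction `v`. For `v` tangent to `X` at `p` this is the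
intrinsic derivative `df(v)`; the normal direction `i Im z` of `X` is annihilated. -/
def tder [Fact (0 < ε)] (f : X n ε → V) (p : X n ε) (v : EuclideanSpace ℂ (Fin n)) : V :=
  fderiv ℝ (ext f) (rep p) v

theorem ext_add_lattice [Fact (0 < ε)] (f : X n ε → V) (z : EuclideanSpace ℂ (Fin n))
    {l : EuclideanSpace ℂ (Fin n)} (hl : l ∈ lattice n) : ext f (z + l) = ext f z := by
  by_cases h : imPart z = 0
  · simp [ext, imPart_add_lattice z hl, h]
  · simp only [ext, imPart_add_lattice z hl, h, dite_false]
    congr 1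
    apply Subtype.ext
    simp only [param]
    refine (QuotientAddGroup.eq).mpr ?_
    obtain ⟨k, hk⟩ := hl
    refine ⟨-k, fun j => ?_⟩
    have h2 : (l j).re = 2 * Real.pi * (k j : ℝ) := by
      rw [hk j]; simp
    simp [ofReIm, rePart, h2]
    ring

/-- The derivative does not depend on the representative. -/
theorem fderiv_ext_eq_tder [Fact (0 < ε)] (f : X n ε → V) (p : X n ε)
    (z : EuclideanSpace ℂ (Fin n)) (hz : (QuotientAddGroup.mk z : TorusC n) = p.1) :
    fderiv ℝ (ext f) z = fun v => tder f p v := by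
  have h : (QuotientAddGroup.mk (rep p) : TorusC n) = p.1 := Quotient.out_eq p.1
  have hl : -z + rep p ∈ lattice n := QuotientAddGroup.eq.mp (hz.trans h.symm)
  have h1 : (fun w => ext f (w + (-z + rep p))) = ext f :=
    funext fun w => ext_add_lattice f w hl
  have h2 := fderiv_comp_add_right (𝕜 := ℝ) (f := ext f) (x := z) (-z + rep p)
  rw [h1, add_neg_cancel_left] at h2
  funext v
  rw [h2]; rfl

theorem ext_add [Fact (0 < ε)] (f g : X n ε → V) : ext (f + g) = ext f + ext g := by
  funext z
  by_cases h : imPart z = 0 <;> simp [ext, h]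

theorem ext_smul [NormedSpace ℂ V] [Fact (0 < ε)] (c : ℂ) (f : X n ε → V) :
    ext (c • f) = c • ext f := by
  funext z
  by_cases h : imPart z = 0 <;> simp [ext, h]

theorem imPart_rep_ne_zero [hε : Fact (0 < ε)] (p : X n ε) : imPart (rep p) ≠ 0 := by
  rw [← norm_ne_zero_iff, norm_imPart_rep]; exact hε.out.ne'

theorem IsSmooth.zero [Fact (0 < ε)] : IsSmooth (0 : X n ε → V) := by
  intro z _
  have : ext (0 : X n ε → V) = fun _ => 0 := by
    funext w; by_cases h : imPart w = 0 <;> simp [ext, h]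
  rw [this]; exact contDiffAt_const

theorem IsSmooth.add [Fact (0 < ε)] {f g : X n ε → V} (hf : IsSmooth f) (hg : IsSmooth g) :
    IsSmooth (f + g) := fun z hz => by
  rw [ext_add]; exact (hf z hz).add (hg z hz)

theorem IsSmooth.smul [Fact (0 < ε)] [NormedSpace ℂ V] (c : ℂ) {f : X n ε → V}
    (hf : IsSmooth f) : IsSmooth (c • f) := fun z hz => by
  rw [ext_smul]; exact (hf z hz).const_smul c

theorem IsSmooth.differentiableAt [Fact (0 < ε)] {f : X n ε → V} (hf : IsSmooth f)
    (p : X n ε) : DifferentiableAt ℝ (ext f) (rep p) :=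
  (hf _ (imPart_rep_ne_zero p)).differentiableAt (by simp)

theorem tder_add [Fact (0 < ε)] {f g : X n ε → V} (hf : IsSmooth f) (hg : IsSmooth g)
    (p : X n ε) (v : EuclideanSpace ℂ (Fin n)) :
    tder (f + g) p v = tder f p v + tder g p v := by
  simp only [tder, ext_add]
  rw [fderiv_add (hf.differentiableAt p) (hg.differentiableAt p)]; rfl

theorem tder_smul [NormedSpace ℂ V] [Fact (0 < ε)] (c : ℂ) {f : X n ε → V}
    (hf : IsSmooth f) (p : X n ε) (v : EuclideanSpace ℂ (Fin n)) :
    tder (c • f) p v = c • tder f p v := by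
  simp only [tder, ext_smul]
  rw [fderiv_const_smul (hf.differentiableAt p)]; rfl

theorem tder_zero [Fact (0 < ε)] (p : X n ε) (v : EuclideanSpace ℂ (Fin n)) :
    tder (0 : X n ε → V) p v = 0 := by
  have : ext (0 : X n ε → V) = fun _ => 0 := by
    funext w; by_cases h : imPart w = 0 <;> simp [ext, h]
  simp [tder, this]

end Smooth

/-- The vector field `T = ∑ⱼ yⱼ ∂/∂xⱼ`, acting on functions on `X`. -/
def fieldT [Fact (0 < ε)] (f : X n ε → ℂ) (p : X n ε) : ℂ :=
  tder f p (ofReIm (imPart (rep p)) 0)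

/-! ### The tangential Cauchy-Riemann operator, the Kohn Laplacian, and `H⁰_b(X)`

`T⁰'¹X` at `[x + i y]` consists of the vectors `∑ⱼ wⱼ ∂/∂z̄ⱼ` with `∑ⱼ wⱼ yⱼ = 0`. A `(0,1)`-covector
of `X` is written as `∑ⱼ aⱼ dz̄ⱼ / √2` with `∑ⱼ aⱼ yⱼ = 0`; its length, in the metric induced by the
flat one (for which `∂/∂xⱼ`, `∂/∂yⱼ` are orthonormal), is the Euclidean length of `a ∈ ℂⁿ`. -/

/-- The coefficients of `√2 ∂̄F = ∑ⱼ √2 (∂F/∂z̄ⱼ) dz̄ⱼ / √2` at `p`, where `F = ext f`. -/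
def dbarCoeff [Fact (0 < ε)] (f : X n ε → ℂ) (p : X n ε) (j : Fin n) : ℂ :=
  (tder f p (ofReIm (EuclideanSpace.single j 1) 0) +
    Complex.I * tder f p (ofReIm 0 (EuclideanSpace.single j 1))) / (Real.sqrt 2 : ℂ)

/-- `∂̄_b f`, the orthogonal projection of `df` to the `(0,1)`-covectors of `X`. -/
def dbarB [Fact (0 < ε)] (f : X n ε → ℂ) (p : X n ε) : EuclideanSpace ℂ (Fin n) :=
  WithLp.toLp 2 fun j =>
    dbarCoeff f p j -
      (∑ k, dbarCoeff f p k * (imPart (rep p) k : ℂ)) / (ε : ℂ) ^ 2 * (imPart (rep p) j : ℂ)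

/-- `a ∈ ℂⁿ` represents a `(0,1)`-covector of `X` at `p`. -/
def IsForm01At (p : X n ε) (a : EuclideanSpace ℂ (Fin n)) : Prop :=
  ∑ j, a j * (imPart (rep p) j : ℂ) = 0

theorem isForm01At_dbarB [hε : Fact (0 < ε)] (f : X n ε → ℂ) (p : X n ε) :
    IsForm01At p (dbarB f p) := by
  have h1 : ∑ j, (imPart (rep p) j : ℂ) * (imPart (rep p) j : ℂ) = (ε : ℂ) ^ 2 := by
    have h := EuclideanSpace.real_norm_sq_eq (imPart (rep p))
    rw [norm_imPart_rep] at h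
    rw [← Complex.ofReal_pow, h]
    push_cast
    exact Finset.sum_congr rfl fun j _ => by ring
  have h2 : (ε : ℂ) ^ 2 ≠ 0 := pow_ne_zero 2 (by exact_mod_cast hε.out.ne')
  simp only [IsForm01At, dbarB, sub_mul, Finset.sum_sub_distrib, mul_assoc]
  rw [← Finset.mul_sum, h1, div_mul_cancel₀ _ h2, sub_self]

/-- The Hilbert space `L²(X)`. -/
abbrev L2 (n : ℕ) (ε : ℝ) [Fact (0 < ε)] : Type := Lp ℂ 2 (vol n ε)

/-- The Hilbert space `L²₍₀,₁₎(X)` of square integrable `(0,1)`-forms. -/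
def L2Form (n : ℕ) (ε : ℝ) [Fact (0 < ε)] :
    Submodule ℂ (Lp (EuclideanSpace ℂ (Fin n)) 2 (vol n ε)) where
  carrier := {α | ∀ᵐ p ∂(vol n ε), IsForm01At p (α p)}
  zero_mem' := by
    filter_upwards [Lp.coeFn_zero (EuclideanSpace ℂ (Fin n)) 2 (vol n ε)] with p hp
    rw [IsForm01At]; erw [hp]; simp
  add_mem' := by
    intro α β hα hβ
    filter_upwards [hα, hβ, Lp.coeFn_add α β] with p h1 h2 h3
    simp only [IsForm01At, h3, Pi.add_apply, PiLp.add_apply, add_mul, Finset.sum_add_distrib] at *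
    rw [h1, h2, add_zero]
  smul_mem' := by
    intro c α hα
    filter_upwards [hα, Lp.coeFn_smul c α] with p h1 h3
    simp only [IsForm01At, h3, Pi.smul_apply, PiLp.smul_apply, smul_eq_mul, mul_assoc,
      ← Finset.mul_sum] at *
    rw [h1, mul_zero]

/-- `C^∞(X)` as a subspace of `L²(X)`. -/
def smoothFun (n : ℕ) (ε : ℝ) [Fact (0 < ε)] : Submodule ℂ (L2 n ε) where
  carrier := {u | ∃ f : X n ε → ℂ, IsSmooth f ∧ u =ᵐ[vol n ε] f}
  zero_mem' := ⟨0, IsSmooth.zero, Lp.coeFn_zero _ _ _⟩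
  add_mem' := by
    rintro u v ⟨f, hf, hu⟩ ⟨g, hg, hv⟩
    exact ⟨f + g, hf.add hg, (Lp.coeFn_add u v).trans (hu.add hv)⟩
  smul_mem' := by
    rintro c u ⟨f, hf, hu⟩
    exact ⟨c • f, hf.smul c, (Lp.coeFn_smul c u).trans (hu.const_smul c)⟩

/-- The smooth `(0,1)`-forms `Ω⁰'¹(X)` as a subspace of `L²₍₀,₁₎(X)`. -/
def smoothForm (n : ℕ) (ε : ℝ) [Fact (0 < ε)] : Submodule ℂ (L2Form n ε) where
  carrier := {α | ∃ φ : X n ε → EuclideanSpace ℂ (Fin n), IsSmooth φ ∧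
    (∀ p, IsForm01At p (φ p)) ∧ α.1 =ᵐ[vol n ε] φ}
  zero_mem' := ⟨0, IsSmooth.zero, fun p => by simp [IsForm01At], Lp.coeFn_zero _ _ _⟩
  add_mem' := by
    rintro u v ⟨f, hf, hf', hu⟩ ⟨g, hg, hg', hv⟩
    refine ⟨f + g, hf.add hg, fun p => ?_, (Lp.coeFn_add u.1 v.1).trans (hu.add hv)⟩
    have h1 := hf' p
    have h2 := hg' p
    simp only [IsForm01At, Pi.add_apply, PiLp.add_apply, add_mul, Finset.sum_add_distrib] at *
    rw [h1, h2, add_zero]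
  smul_mem' := by
    rintro c u ⟨f, hf, hf', hu⟩
    refine ⟨c • f, hf.smul c, fun p => ?_, (Lp.coeFn_smul c u.1).trans (hu.const_smul c)⟩
    have h1 := hf' p
    simp only [IsForm01At, Pi.smul_apply, PiLp.smul_apply, smul_eq_mul, mul_assoc,
      ← Finset.mul_sum] at *
    rw [h1, mul_zero]

theorem dbarB_add [Fact (0 < ε)] {f g : X n ε → ℂ} (hf : IsSmooth f) (hg : IsSmooth g) :
    dbarB (f + g) = dbarB f + dbarB g := by
  have h : ∀ p j, dbarCoeff (f + g) p j = dbarCoeff f p j + dbarCoeff g p j := fun p j => by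
    simp only [dbarCoeff, tder_add hf hg]; ring
  funext p
  ext j
  simp only [dbarB, h, Pi.add_apply, PiLp.add_apply, add_mul, Finset.sum_add_distrib]
  ring

theorem dbarB_smul [Fact (0 < ε)] (c : ℂ) {f : X n ε → ℂ} (hf : IsSmooth f) :
    dbarB (c • f) = c • dbarB f := by
  have h : ∀ p j, dbarCoeff (c • f) p j = c * dbarCoeff f p j := fun p j => by
    simp only [dbarCoeff, tder_smul c hf, smul_eq_mul]; ring
  funext p
  ext j
  simp only [dbarB, h, Pi.smul_apply, PiLp.smul_apply, smul_eq_mul, mul_assoc, ← Finset.mul_sum]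
  ring

theorem dbarB_zero [Fact (0 < ε)] : dbarB (0 : X n ε → ℂ) = 0 := by
  funext p
  ext j
  simp [dbarB, dbarCoeff, tder_zero]

/-- The graph of `∂̄_b : C^∞(X) → Ω⁰'¹(X)`. -/
def dbarSmooth (n : ℕ) (ε : ℝ) [Fact (0 < ε)] : Submodule ℂ (L2 n ε × L2Form n ε) where
  carrier := {q | ∃ f : X n ε → ℂ, IsSmooth f ∧ q.1 =ᵐ[vol n ε] f ∧ q.2.1 =ᵐ[vol n ε] dbarB f}
  zero_mem' := ⟨0, IsSmooth.zero, Lp.coeFn_zero _ _ _, by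
    rw [dbarB_zero]; exact Lp.coeFn_zero _ _ _⟩
  add_mem' := by
    rintro u v ⟨f, hf, hu, hu'⟩ ⟨g, hg, hv, hv'⟩
    refine ⟨f + g, hf.add hg, (Lp.coeFn_add u.1 v.1).trans (hu.add hv), ?_⟩
    rw [dbarB_add hf hg]
    exact (Lp.coeFn_add u.2.1 v.2.1).trans (hu'.add hv')
  smul_mem' := by
    rintro c u ⟨f, hf, hu, hu'⟩
    refine ⟨c • f, hf.smul c, (Lp.coeFn_smul c u.1).trans (hu.const_smul c), ?_⟩
    rw [dbarB_smul c hf]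
    exact (Lp.coeFn_smul c u.2.1).trans (hu'.const_smul c)

/-- The graph of the formal adjoint `∂̄_b^* : Ω⁰'¹(X) → C^∞(X)`: the pairs of smooth `φ`, `ψ` with
`(∂̄_b f | φ) = (f | ψ)` for all `f ∈ C^∞(X)`. -/
def dbarFormalAdjoint (n : ℕ) (ε : ℝ) [Fact (0 < ε)] : Submodule ℂ (L2Form n ε × L2 n ε) :=
  (dbarSmooth n ε).adjoint ⊓ (smoothForm n ε).prod (smoothFun n ε)

/-- The graph of the `L²` extension `∂̄_b : Dom ∂̄_b ⊂ L²(X) → L²₍₀,₁₎(X)`,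
`Dom ∂̄_b = {u : ∂̄_b u ∈ L²₍₀,₁₎(X)}` in the sense of distributions: `∂̄_b u = α` if and only if
`(u | ∂̄_b^* φ) = (α | φ)` for all `φ ∈ Ω⁰'¹(X)`. -/
def dbar (n : ℕ) (ε : ℝ) [Fact (0 < ε)] : Submodule ℂ (L2 n ε × L2Form n ε) :=
  (dbarFormalAdjoint n ε).adjoint

/-- The graph of the `L²` adjoint of `∂̄_b : Dom ∂̄_b → L²₍₀,₁₎(X)`. -/
def dbarStar (n : ℕ) (ε : ℝ) [Fact (0 < ε)] : Submodule ℂ (L2Form n ε × L2 n ε) :=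
  (dbar n ε).adjoint

/-- `u ∈ Dom □_b` and `□_b u = w`, for the Kohn Laplacian `□_b = ∂̄_b^* ∂̄_b` on functions. -/
def IsBox [Fact (0 < ε)] (u w : L2 n ε) : Prop :=
  ∃ α : L2Form n ε, (u, α) ∈ dbar n ε ∧ (α, w) ∈ dbarStar n ε

/-- The space `H⁰_b(X) = Ker □_b` of square integrable CR functions. -/
def Hb (n : ℕ) (ε : ℝ) [Fact (0 < ε)] : Submodule ℂ (L2 n ε) where
  carrier := {u | IsBox u 0}
  zero_mem' := ⟨0, (dbar n ε).zero_mem, (dbarStar n ε).zero_mem⟩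
  add_mem' := by
    rintro u v ⟨α, h1, h2⟩ ⟨β, h3, h4⟩
    exact ⟨α + β, (dbar n ε).add_mem h1 h3, by simpa using (dbarStar n ε).add_mem h2 h4⟩
  smul_mem' := by
    rintro c u ⟨α, h1, h2⟩
    exact ⟨c • α, (dbar n ε).smul_mem c h1, by simpa using (dbarStar n ε).smul_mem c h2⟩

theorem mem_Hb_iff [Fact (0 < ε)] (u : L2 n ε) : u ∈ Hb n ε ↔ (u, 0) ∈ dbar n ε := by
  constructor
  · rintro ⟨α, h1, h2⟩
    have h := (Submodule.mem_adjoint_iff (dbar n ε) (α, 0)).mp h2 u α h1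
    simp only [inner_zero_right, sub_zero, inner_self_eq_zero] at h
    rwa [h] at h1
  · intro h
    exact ⟨0, h, (dbarStar n ε).zero_mem⟩

theorem isClosed_Hb [Fact (0 < ε)] : IsClosed (Hb n ε : Set (L2 n ε)) := by
  have h : (Hb n ε : Set (L2 n ε)) =
      ⋂ q ∈ dbarFormalAdjoint n ε, {u : L2 n ε | inner ℂ q.2 u = 0} := by
    ext u
    simp only [SetLike.mem_coe, mem_Hb_iff, dbar, Submodule.mem_adjoint_iff, inner_zero_right,
      sub_zero, Set.mem_iInter, Set.mem_ofPred_eq, Prod.forall]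
  rw [h]
  refine isClosed_biInter fun q _ => ?_
  exact isClosed_eq (by fun_prop) continuous_const

instance [Fact (0 < ε)] : CompleteSpace (Hb n ε) := isClosed_Hb.completeSpace_coe

/-- The Szegő projection `Π : L²(X) → H⁰_b(X) ⊂ L²(X)`. -/
def szego (n : ℕ) (ε : ℝ) [Fact (0 < ε)] : L2 n ε →L[ℂ] L2 n ε := (Hb n ε).starProjection

/-! ### The Toeplitz operator and the functions `s_m` -/

/-- The graph of `T : C^∞(X) → C^∞(X)`. -/
def graphT (n : ℕ) (ε : ℝ) [Fact (0 < ε)] : Submodule ℂ (L2 n ε × L2 n ε) where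
  carrier := {q | ∃ f : X n ε → ℂ, IsSmooth f ∧ q.1 =ᵐ[vol n ε] f ∧ q.2 =ᵐ[vol n ε] fieldT f}
  zero_mem' := ⟨0, IsSmooth.zero, Lp.coeFn_zero _ _ _, by
    have : fieldT (0 : X n ε → ℂ) = 0 := funext fun p => tder_zero p _
    rw [this]; exact Lp.coeFn_zero _ _ _⟩
  add_mem' := by
    rintro u v ⟨f, hf, hu, hu'⟩ ⟨g, hg, hv, hv'⟩
    refine ⟨f + g, hf.add hg, (Lp.coeFn_add u.1 v.1).trans (hu.add hv), ?_⟩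
    have : fieldT (f + g) = fieldT f + fieldT g := funext fun p => tder_add hf hg p _
    rw [this]
    exact (Lp.coeFn_add u.2 v.2).trans (hu'.add hv')
  smul_mem' := by
    rintro c u ⟨f, hf, hu, hu'⟩
    refine ⟨c • f, hf.smul c, (Lp.coeFn_smul c u.1).trans (hu.const_smul c), ?_⟩
    have : fieldT (c • f) = c • fieldT f := funext fun p => tder_smul c hf p _
    rw [this]
    exact (Lp.coeFn_smul c u.2).trans (hu'.const_smul c)

/-- The graph of the Toeplitz operator `A = Π (i/ε) T Π`, as a composition of operators in `L²(X)`
where `T` has the domain `C^∞(X)`: `A u` is defined if `Π u ∈ C^∞(X)`. -/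
def graphA (n : ℕ) (ε : ℝ) [Fact (0 < ε)] : Submodule ℂ (L2 n ε × L2 n ε) where
  carrier := {q | ∃ v, (szego n ε q.1, v) ∈ graphT n ε ∧
    q.2 = szego n ε ((Complex.I / (ε : ℂ)) • v)}
  zero_mem' := ⟨0, by rw [Prod.fst_zero, map_zero]; exact (graphT n ε).zero_mem, by simp⟩
  add_mem' := by
    rintro a b ⟨v, h1, h2⟩ ⟨w, h3, h4⟩
    exact ⟨v + w, by simpa using (graphT n ε).add_mem h1 h3, by simp [h2, h4]⟩
  smul_mem' := by
    rintro c a ⟨v, h1, h2⟩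
    exact ⟨c • v, by simpa using (graphT n ε).smul_mem c h1, by
      simp [h2, smul_smul, mul_comm c]⟩

/-- `γ_n(t) = ∫₀^π e^{t cos α} sin^{n-2} α dα`, for `n ≥ 2`. -/
def gam (n : ℕ) (t : ℝ) : ℝ :=
  ∫ α in (0 : ℝ)..Real.pi, Real.exp (t * Real.cos α) * Real.sin α ^ (n - 2)

/-- `vol(S^{n-2})`, the surface measure of the unit sphere in `ℝ^{n-1}`, for `n ≥ 2`
(for `n = 2` this is `2`). -/
def volSphere (n : ℕ) : ℝ :=
  (volume : Measure (EuclideanSpace ℝ (Fin (n - 1)))).toSphere.real Set.univ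

/-- The Euclidean length of `m ∈ ℤⁿ`. -/
def len (m : Fin n → ℤ) : ℝ := Real.sqrt (∑ j, (m j : ℝ) ^ 2)

/-- The function `[z] ↦ e^{i⟨m,z⟩}` on `M`, where `⟨m,z⟩ = ∑ⱼ mⱼ zⱼ`. -/
def character (m : Fin n → ℤ) : TorusC n → ℂ :=
  Quotient.lift (fun z : EuclideanSpace ℂ (Fin n) => Complex.exp (Complex.I * ∑ j, (m j : ℂ) * z j))
    (by
      intro a b hab
      obtain ⟨k, hk⟩ : -a + b ∈ lattice n := QuotientAddGroup.leftRel_apply.mp hab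
      refine Complex.exp_eq_exp_iff_exists_int.mpr ⟨-∑ j, m j * k j, ?_⟩
      have hb : ∀ j, b j = a j + 2 * (Real.pi : ℂ) * (k j : ℂ) := fun j => by
        have := hk j
        simp only [PiLp.add_apply, PiLp.neg_apply] at this
        rw [← this]; ring
      simp only [hb, mul_add, Finset.sum_add_distrib, Int.cast_neg, Int.cast_sum, Int.cast_mul,
        neg_mul, Finset.sum_mul, Finset.mul_sum]
      rw [← sub_eq_add_neg, eq_sub_iff_add_eq]
      congr 1
      exact Finset.sum_congr rfl fun j _ => by ring)

/-- The normalized function `s_m` on `X`. -/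
def sFun (n : ℕ) (ε : ℝ) (m : Fin n → ℤ) (p : X n ε) : ℂ :=
  character m p.1 /
    (((2 * Real.pi) ^ ((n : ℝ) / 2) *
      Real.sqrt (ε ^ (n - 1) * gam n (2 * ε * len m) * volSphere n) : ℝ) : ℂ)

end GrauertTube

end

/-!
The theorem rests on Fourier analysis in `x = Re z` and on one fact about the sphere `|y| = ε`: a
distribution on a sphere that is killed by all infinitesimal rotations is a constant.

*The space `H⁰_b(X)`.* The functions `e^{i⟨m, z⟩}` are restrictions of holomorphic functions, so
they are smooth with `∂̄_b = 0`, and a smooth CR function lies in the kernel of the weak operator by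
definition of the latter (`mem_Hb_of_dbarB_eq_zero`). For completeness, let `u` be a CR function. It
is tested against the `(0,1)`-forms `e^{i⟨m, z⟩ + ⟨ζ, y⟩} K`, where `K` is the field of infinitesimal
rotations of `y` in the plane of two orthonormal vectors `a`, `b`. The translations in `x` and the
rotations of `y` preserve the volume, so integration by parts computes the formal adjoint of `∂̄_b` on
these forms (`integral_dbarB_testForm`). With `ζ = 2m + r a` the result says that the function
`ξ ↦ ∫ ū e^{i⟨m, z⟩ + ⟨2m + ξ, y⟩}` has derivative zero at `r a` in the direction `b`
(`integral_conj_mul_wave_moment`); hence it is constant on spheres (`transform_circle`). Its average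
over the sphere of radius `r` is, by Fubini and because the average of `e^{r⟨η, y⟩}` over unit vectors
`η` depends only on `|y| = ε`, a positive multiple of its value at `0` (`transform_average`). If `u` is
orthogonal to all `e^{i⟨m, z⟩}`, then it vanishes at `ξ = -2m`, so at `0`, so everywhere. The
exponentials `e^{i⟨m, z⟩ + ⟨ζ, y⟩}` span a star algebra separating the points of the compact space
`X`, so `u = 0` by the Stone-Weierstrass theorem (`eq_zero_of_integral_conj_mul_wave`).

*Norms and eigenvalues.* Different `m` are orthogonal because of the integral over `x`. For equal `m`
the integrals over `y` are those of `e^{⟨v, w⟩}` and `⟨v, w⟩ e^{⟨v, w⟩}` over the unit sphere, with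
`v = -2 ε m`. Slicing the sphere orthogonally to `v` gives `γ_n(|v|)` and `|v| γ_n'(|v|)`, up to the
volume of `S^{n-2}` (`integral_sphere_exp`, `integral_sphere_inner_mul_exp`). The slicing formula
follows from computing a Gaussian integral over `ℝⁿ = ℝ × ℝ^{n-1}` in polar coordinates in two ways
(`lintegral_sphere_coord`). Finally `T` multiplies `e^{i⟨m, z⟩}` by `i⟨m, y⟩`, so that `A s_m` is the
projection of `-ε⁻¹⟨m, y⟩ s_m`, whose only nonzero coefficient is the one along `s_m`. The value of `A`
is unique because two smooth functions that agree almost everywhere on `X` agree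
(`eq_of_ae_eq_vol`).
-/

noncomputable section

namespace GrauertTube

open MeasureTheory Metric Set

section SphereIntegrals

open scoped ENNReal

/-! ### Integration over the unit sphere -/

section Polar

variable {E : Type*} [NormedAddCommGroup E] [NormedSpace ℝ E] [MeasurableSpace E] [BorelSpace E]
  [FiniteDimensional ℝ E] [Nontrivial E]

/-- Polar coordinates for a product of an angular and a radial function. -/
theorem lintegral_angular_mul_radial (μ : Measure E) [μ.IsAddHaarMeasure] {f : E → ℝ≥0∞}
    (hf : Measurable f) {g : ℝ → ℝ≥0∞} (hg : Measurable g) :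
    ∫⁻ x, f (‖x‖⁻¹ • x) * g ‖x‖ ∂μ =
      (∫⁻ w, f (w : E) ∂μ.toSphere) *
        ∫⁻ r in Ioi (0 : ℝ), ENNReal.ofReal (r ^ (Module.finrank ℝ E - 1)) * g r := by
  calc ∫⁻ x, f (‖x‖⁻¹ • x) * g ‖x‖ ∂μ
      = ∫⁻ x : ({(0)}ᶜ : Set E), f (‖x.1‖⁻¹ • x.1) * g ‖x.1‖ ∂(μ.comap (↑)) := by
        rw [lintegral_subtype_comap (measurableSet_singleton _).compl
          (fun x : E => f (‖x‖⁻¹ • x) * g ‖x‖), restrict_compl_singleton]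
    _ = ∫⁻ q : sphere (0 : E) 1 × Ioi (0 : ℝ), f q.1 * g q.2
          ∂μ.toSphere.prod (.volumeIoiPow (Module.finrank ℝ E - 1)) := by
        rw [← μ.measurePreserving_homeomorphUnitSphereProd.lintegral_comp_emb
          (Homeomorph.measurableEmbedding _)]
        simp
    _ = (∫⁻ w, f (w : E) ∂μ.toSphere) *
          ∫⁻ r : Ioi (0 : ℝ), g r ∂(.volumeIoiPow (Module.finrank ℝ E - 1)) :=
        lintegral_prod_mul (f := fun w : sphere (0 : E) 1 => f w)
          (g := fun r : Ioi (0 : ℝ) => g r) (by fun_prop) (by fun_prop)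
    _ = _ := by
        rw [Measure.volumeIoiPow, lintegral_withDensity_eq_lintegral_mul _ (by fun_prop)
          (by fun_prop)]
        simp only [Pi.mul_apply]
        rw [lintegral_subtype_comap measurableSet_Ioi
          (fun r : ℝ => ENNReal.ofReal (r ^ (Module.finrank ℝ E - 1)) * g r)]

/-- The radial factor of the Gaussian weight used to pass from the sphere to the whole space. -/
theorem radial_gaussian_ne_zero_top (k : ℕ) :
    (∫⁻ r in Ioi (0 : ℝ), ENNReal.ofReal (r ^ k) * ENNReal.ofReal (Real.exp (-r ^ 2))) ≠ 0 ∧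
      (∫⁻ r in Ioi (0 : ℝ), ENNReal.ofReal (r ^ k) * ENNReal.ofReal (Real.exp (-r ^ 2))) ≠ ∞ := by
  have hm : Measurable fun r : ℝ =>
      ENNReal.ofReal (r ^ k) * ENNReal.ofReal (Real.exp (-r ^ 2)) := by fun_prop
  constructor
  · intro h
    rw [lintegral_eq_zero_iff hm, Filter.EventuallyEq, ae_restrict_iff' measurableSet_Ioi] at h
    have h0 : volume (Ioi (0 : ℝ)) = 0 := by
      refine measure_mono_null ?_ (ae_iff.mp h)
      intro r (hr : 0 < r)
      simp only [mem_ofPred_eq, Classical.not_imp, Pi.zero_apply, mul_eq_zero,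
        ENNReal.ofReal_eq_zero, not_or, not_le]
      exact ⟨hr, by positivity, by positivity⟩
    simp at h0
  · have hi := integrableOn_rpow_mul_exp_neg_mul_sq (b := 1) one_pos (s := k)
      (by have : (0 : ℝ) ≤ k := k.cast_nonneg
          linarith)
    have hi2 := hi.lintegral_lt_top
    refine ne_of_lt (lt_of_eq_of_lt ?_ hi2)
    refine setLIntegral_congr_fun measurableSet_Ioi fun r (hr : 0 < r) => ?_
    simp only [Real.rpow_natCast]
    rw [← ENNReal.ofReal_mul (by positivity)]
    simp

end Polar

variable {n : ℕ}

/-- A linear isometry restricted to the unit sphere. -/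
def sphereMap (L : EuclideanSpace ℝ (Fin n) ≃ₗᵢ[ℝ] EuclideanSpace ℝ (Fin n))
    (w : sphere (0 : EuclideanSpace ℝ (Fin n)) 1) : sphere (0 : EuclideanSpace ℝ (Fin n)) 1 :=
  ⟨L w, by simp⟩

theorem continuous_sphereMap (L : EuclideanSpace ℝ (Fin n) ≃ₗᵢ[ℝ] EuclideanSpace ℝ (Fin n)) :
    Continuous (sphereMap L) :=
  Continuous.subtype_mk (by fun_prop) _

/-- The surface measure of the unit sphere is invariant under linear isometries: so is the cone
over it with a radial weight. -/
theorem lintegral_sphere_comp_isometry [NeZero n]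
    (L : EuclideanSpace ℝ (Fin n) ≃ₗᵢ[ℝ] EuclideanSpace ℝ (Fin n))
    {f : EuclideanSpace ℝ (Fin n) → ℝ≥0∞} (hf : Measurable f) :
    ∫⁻ w, f (L w) ∂(volume : Measure (EuclideanSpace ℝ (Fin n))).toSphere =
      ∫⁻ w, f w ∂(volume : Measure (EuclideanSpace ℝ (Fin n))).toSphere := by
  have hg : Measurable fun r : ℝ => ENNReal.ofReal (Real.exp (-r ^ 2)) := by fun_prop
  have hc := radial_gaussian_ne_zero_top (Module.finrank ℝ (EuclideanSpace ℝ (Fin n)) - 1)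
  have h1 := lintegral_angular_mul_radial (volume : Measure (EuclideanSpace ℝ (Fin n))) hf hg
  have h2 := lintegral_angular_mul_radial (volume : Measure (EuclideanSpace ℝ (Fin n)))
    (hf.comp L.continuous.measurable) hg
  rw [← L.measurePreserving.lintegral_comp (by fun_prop)] at h1
  simp only [LinearIsometryEquiv.norm_map, Function.comp_def, map_smul] at h1 h2
  rw [h1] at h2
  exact (ENNReal.mul_left_inj hc.1 hc.2).mp h2.symm

theorem measurePreserving_sphereMap [NeZero n]
    (L : EuclideanSpace ℝ (Fin n) ≃ₗᵢ[ℝ] EuclideanSpace ℝ (Fin n)) :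
    MeasurePreserving (sphereMap L) (volume : Measure (EuclideanSpace ℝ (Fin n))).toSphere
      (volume : Measure (EuclideanSpace ℝ (Fin n))).toSphere := by
  refine ⟨(continuous_sphereMap L).measurable, ?_⟩
  refine Measure.ext fun s hs => ?_
  rw [Measure.map_apply (continuous_sphereMap L).measurable hs]
  have hemb : MeasurableEmbedding (Subtype.val : sphere (0 : EuclideanSpace ℝ (Fin n)) 1 → _) :=
    MeasurableEmbedding.subtype_coe isClosed_sphere.measurableSet
  have hs' : MeasurableSet (Subtype.val '' s) := hemb.measurableSet_image.mpr hs
  have h := lintegral_sphere_comp_isometry L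
    (f := (Subtype.val '' s).indicator fun _ => 1) (by measurability)
  have e1 : ∀ w : sphere (0 : EuclideanSpace ℝ (Fin n)) 1,
      (Subtype.val '' s).indicator (fun _ => (1 : ℝ≥0∞)) (w : EuclideanSpace ℝ (Fin n)) =
        s.indicator (fun _ => 1) w := fun w => by
    by_cases hw : w ∈ s
    · rw [indicator_of_mem hw, indicator_of_mem (mem_image_of_mem _ hw)]
    · rw [indicator_of_notMem hw, indicator_of_notMem
        (fun h => hw ((Subtype.val_injective.mem_set_image).mp h))]
  have e2 : ∀ w : sphere (0 : EuclideanSpace ℝ (Fin n)) 1,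
      (Subtype.val '' s).indicator (fun _ => (1 : ℝ≥0∞)) (L w) =
        (sphereMap L ⁻¹' s).indicator (fun _ => 1) w := fun w => by
    have := e1 (sphereMap L w)
    rw [show (L w : EuclideanSpace ℝ (Fin n)) = (sphereMap L w : EuclideanSpace ℝ (Fin n))
      from rfl, this]
    rfl
  simp only [e1, e2] at h
  rwa [lintegral_indicator_const hs, lintegral_indicator_const
    ((continuous_sphereMap L).measurable hs), one_mul, one_mul] at h

/-- Splitting off the first coordinate of `ℝ^{k+1}`. -/
theorem lintegral_euclidean_succ (k : ℕ) {F : ℝ → ℝ → ℝ≥0∞}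
    (hF : Measurable (Function.uncurry F)) :
    ∫⁻ x : EuclideanSpace ℝ (Fin (k + 1)), F (x 0) ‖x‖ =
      ∫⁻ t : ℝ, ∫⁻ y : EuclideanSpace ℝ (Fin k), F t (Real.sqrt (t ^ 2 + ‖y‖ ^ 2)) := by
  have hn : ∀ {j : ℕ} (x : EuclideanSpace ℝ (Fin j)), ‖x‖ = Real.sqrt (∑ i, x i ^ 2) := fun x => by
    rw [EuclideanSpace.norm_eq]; simp
  have e1 : ∫⁻ x : EuclideanSpace ℝ (Fin (k + 1)), F (x 0) ‖x‖ =
      ∫⁻ x : Fin (k + 1) → ℝ, F (x 0) (Real.sqrt (∑ i, x i ^ 2)) := by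
    rw [← (PiLp.volume_preserving_ofLp (Fin (k + 1))).lintegral_comp]
    · exact lintegral_congr fun x => by rw [hn]
    · exact hF.comp (f := fun x : Fin (k + 1) → ℝ => (x 0, Real.sqrt (∑ i, x i ^ 2))) (by fun_prop)
  have e2 : ∀ t : ℝ, ∫⁻ y : EuclideanSpace ℝ (Fin k), F t (Real.sqrt (t ^ 2 + ‖y‖ ^ 2)) =
      ∫⁻ y : Fin k → ℝ, F t (Real.sqrt (t ^ 2 + ∑ i, y i ^ 2)) := fun t => by
    rw [← (PiLp.volume_preserving_ofLp (Fin k)).lintegral_comp]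
    · refine lintegral_congr fun y => ?_
      rw [hn, Real.sq_sqrt (Finset.sum_nonneg fun i _ => sq_nonneg _)]
    · exact hF.comp (f := fun y : Fin k → ℝ => (t, Real.sqrt (t ^ 2 + ∑ i, y i ^ 2))) (by fun_prop)
  simp only [e1, e2]
  rw [← (volume_preserving_piFinSuccAbove (fun _ : Fin (k + 1) => ℝ) 0).symm.lintegral_comp_emb
    (MeasurableEquiv.measurableEmbedding _), Measure.volume_eq_prod, lintegral_prod]
  · refine lintegral_congr fun t => lintegral_congr fun y => ?_
    simp [MeasurableEquiv.piFinSuccAbove, Fin.sum_univ_succ]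
  · refine Measurable.aemeasurable ?_
    exact (hF.comp (f := fun x : Fin (k + 1) → ℝ => (x 0, Real.sqrt (∑ i, x i ^ 2)))
      (by fun_prop)).comp (MeasurableEquiv.measurable _)

/-- Spherical slices, for the direction of the first coordinate: both sides are compared with the
integral over `ℝ × ℝ^{k+1}` of a Gaussian weight. -/
theorem lintegral_sphere_coord (k : ℕ) {F : ℝ → ℝ≥0∞} (hF : Measurable F) :
    ∫⁻ w, F ((w : EuclideanSpace ℝ (Fin (k + 2))) 0)
        ∂(volume : Measure (EuclideanSpace ℝ (Fin (k + 2)))).toSphere =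
      (volume : Measure (EuclideanSpace ℝ (Fin (k + 1)))).toSphere univ *
        ∫⁻ θ in Ioo 0 Real.pi, ENNReal.ofReal (Real.sin θ ^ k) * F (Real.cos θ) := by
  set g : ℝ → ℝ≥0∞ := fun r => ENNReal.ofReal (Real.exp (-r ^ 2)) with hgdef
  have hg : Measurable g := by fun_prop
  have hc := radial_gaussian_ne_zero_top (k + 1)
  set c := ∫⁻ r in Ioi (0 : ℝ), ENNReal.ofReal (r ^ (k + 1)) * ENNReal.ofReal (Real.exp (-r ^ 2))
    with hcdef
  have h1 := lintegral_angular_mul_radial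
    (volume : Measure (EuclideanSpace ℝ (Fin (k + 2))))
    (f := fun x => F (x 0)) (by fun_prop) hg
  have hfr : ∀ j : ℕ, Module.finrank ℝ (EuclideanSpace ℝ (Fin (j + 1))) - 1 = j := fun j => by simp
  rw [hfr (k + 1), ← hcdef] at h1
  refine (ENNReal.mul_left_inj hc.1 hc.2).mp (h1.symm.trans ?_)
  have hG : Measurable (Function.uncurry fun t r : ℝ => F (r⁻¹ * t) * g r) := by
    unfold Function.uncurry; fun_prop
  have h2 := lintegral_euclidean_succ (k + 1) hG
  simp only [PiLp.smul_apply, smul_eq_mul]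
  rw [h2]
  -- the inner integral over `ℝ^{k+1}` is radial
  have h3 : ∀ t : ℝ, ∫⁻ y : EuclideanSpace ℝ (Fin (k + 1)),
      F ((Real.sqrt (t ^ 2 + ‖y‖ ^ 2))⁻¹ * t) * g (Real.sqrt (t ^ 2 + ‖y‖ ^ 2)) =
      (volume : Measure (EuclideanSpace ℝ (Fin (k + 1)))).toSphere univ *
        ∫⁻ s in Ioi (0 : ℝ), ENNReal.ofReal (s ^ k) *
          (F ((Real.sqrt (t ^ 2 + s ^ 2))⁻¹ * t) * g (Real.sqrt (t ^ 2 + s ^ 2))) := fun t => by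
    have h := lintegral_angular_mul_radial
      (volume : Measure (EuclideanSpace ℝ (Fin (k + 1))))
      (f := fun _ => 1) (by fun_prop)
      (g := fun s => F ((Real.sqrt (t ^ 2 + s ^ 2))⁻¹ * t) * g (Real.sqrt (t ^ 2 + s ^ 2)))
      (by fun_prop)
    simpa only [one_mul, lintegral_const, hfr k] using h
  simp only [h3]
  rw [lintegral_const_mul' _ _ (measure_ne_top _ _), mul_assoc]
  congr 1
  -- polar coordinates in the half plane
  have h4 : ∀ t : ℝ, ∫⁻ s in Ioi (0 : ℝ), ENNReal.ofReal (s ^ k) *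
        (F ((Real.sqrt (t ^ 2 + s ^ 2))⁻¹ * t) * g (Real.sqrt (t ^ 2 + s ^ 2))) =
      ∫⁻ s, (Ioi (0 : ℝ)).indicator (fun s => ENNReal.ofReal (s ^ k)) s *
        (F ((Real.sqrt (t ^ 2 + s ^ 2))⁻¹ * t) * g (Real.sqrt (t ^ 2 + s ^ 2))) := fun t => by
    rw [← lintegral_indicator measurableSet_Ioi]
    refine lintegral_congr fun s => ?_
    by_cases hs : s ∈ Ioi (0 : ℝ) <;> simp [hs]
  simp only [h4]
  have hind : Measurable ((Ioi (0 : ℝ)).indicator fun s => ENNReal.ofReal (s ^ k)) :=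
    Measurable.indicator (by fun_prop) measurableSet_Ioi
  rw [← lintegral_prod (f := fun p : ℝ × ℝ =>
    (Ioi (0 : ℝ)).indicator (fun s => ENNReal.ofReal (s ^ k)) p.2 *
        (F ((Real.sqrt (p.1 ^ 2 + p.2 ^ 2))⁻¹ * p.1) * g (Real.sqrt (p.1 ^ 2 + p.2 ^ 2))))
    (Measurable.aemeasurable (by fun_prop)), ← Measure.volume_eq_prod,
    ← lintegral_comp_polarCoord_symm, polarCoord_target, Measure.volume_eq_prod,
    ← Measure.prod_restrict]
  have hpi : Ioo (0 : ℝ) Real.pi = Ioo (-Real.pi) Real.pi ∩ Ioi 0 := by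
    ext θ
    simp only [mem_Ioo, mem_inter_iff, mem_Ioi]
    constructor
    · rintro ⟨h, h'⟩; exact ⟨⟨by linarith, h'⟩, h⟩
    · rintro ⟨⟨_, h'⟩, h⟩; exact ⟨h, h'⟩
  have h5 : ∫⁻ θ in Ioo 0 Real.pi, ENNReal.ofReal (Real.sin θ ^ k) * F (Real.cos θ) =
      ∫⁻ θ in Ioo (-Real.pi) Real.pi, (Ioi (0 : ℝ)).indicator
        (fun θ => ENNReal.ofReal (Real.sin θ ^ k) * F (Real.cos θ)) θ := by
    rw [lintegral_indicator measurableSet_Ioi, Measure.restrict_restrict measurableSet_Ioi,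
      hpi, inter_comm]
  rw [h5, mul_comm, hcdef, ← lintegral_prod_mul (by fun_prop) (Measurable.aemeasurable
    (Measurable.indicator (by fun_prop) measurableSet_Ioi))]
  have hms : MeasurableSet (Ioi (0 : ℝ) ×ˢ Ioo (-Real.pi) Real.pi) :=
    measurableSet_Ioi.prod measurableSet_Ioo
  rw [Measure.prod_restrict]
  refine setLIntegral_congr_fun hms ?_
  rintro ⟨r, θ⟩ ⟨hr, hθ⟩
  simp only [mem_Ioi, mem_Ioo] at hr hθ
  have hsq : Real.sqrt ((r * Real.cos θ) ^ 2 + (r * Real.sin θ) ^ 2) = r := by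
    rw [show (r * Real.cos θ) ^ 2 + (r * Real.sin θ) ^ 2 = r ^ 2 by
      nlinarith [Real.sin_sq_add_cos_sq θ], Real.sqrt_sq hr.le]
  simp only [polarCoord_symm_apply, hsq, smul_eq_mul]
  rw [inv_mul_cancel_left₀ hr.ne']
  by_cases h0 : 0 < θ
  · have hs : 0 < Real.sin θ := Real.sin_pos_of_pos_of_lt_pi h0 hθ.2
    rw [indicator_of_mem (show r * Real.sin θ ∈ Ioi (0 : ℝ) from mul_pos hr hs),
      indicator_of_mem (show θ ∈ Ioi (0 : ℝ) from h0), mul_pow,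
      ENNReal.ofReal_mul (by positivity), pow_succ r k, ENNReal.ofReal_mul (by positivity)]
    simp only [hgdef]
    ring
  · have hs : Real.sin θ ≤ 0 :=
      Real.sin_nonpos_of_nonpos_of_neg_pi_le (not_lt.mp h0) hθ.1.le
    rw [indicator_of_notMem (show r * Real.sin θ ∉ Ioi (0 : ℝ) from
      fun h => absurd (mem_Ioi.mp h) (not_lt.mpr (mul_nonpos_of_nonneg_of_nonpos hr.le hs))),
      indicator_of_notMem (show θ ∉ Ioi (0 : ℝ) from h0)]
    simp

/-- A unit vector is the first coordinate of some isometric coordinates. -/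
theorem exists_isometry_coord_eq_inner (k : ℕ) (u : EuclideanSpace ℝ (Fin (k + 1)))
    (hu : ‖u‖ = 1) : ∃ L : EuclideanSpace ℝ (Fin (k + 1)) ≃ₗᵢ[ℝ] EuclideanSpace ℝ (Fin (k + 1)),
      ∀ x, (L x) 0 = inner ℝ u x := by
  have hv : Orthonormal ℝ (({0} : Set (Fin (k + 1))).domRestrict fun _ => u) := by
    refine ⟨fun i => hu, fun i j hij => absurd (Subsingleton.elim i j) hij⟩
  obtain ⟨b, hb⟩ := hv.exists_orthonormalBasis_extension_of_card_eq (by simp)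
  refine ⟨b.repr, fun x => ?_⟩
  rw [b.repr_apply_apply, hb 0 (by simp)]

/-- The law of `⟨u, w⟩` for `w` on the unit sphere of `ℝ^{k+2}`. -/
theorem map_inner_toSphere (k : ℕ) (u : EuclideanSpace ℝ (Fin (k + 2))) (hu : ‖u‖ = 1) :
    Measure.map (fun w : sphere (0 : EuclideanSpace ℝ (Fin (k + 2))) 1 => inner ℝ u (w : _))
        (volume : Measure (EuclideanSpace ℝ (Fin (k + 2)))).toSphere =
      (volume : Measure (EuclideanSpace ℝ (Fin (k + 1)))).toSphere univ •
        Measure.map Real.cos ((volume.restrict (Ioo 0 Real.pi)).withDensity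
          fun θ => ENNReal.ofReal (Real.sin θ ^ k)) := by
  obtain ⟨L, hL⟩ := exists_isometry_coord_eq_inner (k + 1) u hu
  refine Measure.ext_of_lintegral _ fun F hF => ?_
  rw [lintegral_map hF (by fun_prop), lintegral_smul_measure, lintegral_map hF (by fun_prop),
    lintegral_withDensity_eq_lintegral_mul _ (by fun_prop) (by fun_prop), smul_eq_mul]
  simp only [Pi.mul_apply]
  rw [← lintegral_sphere_coord k hF, ← lintegral_sphere_comp_isometry L
    (f := fun x => F (x 0)) (by fun_prop)]
  simp only [hL]

/-- Spherical slices: a zonal function is integrated over the sphere by integrating over the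
angle to its axis. -/
theorem integral_sphere_inner (k : ℕ) (u : EuclideanSpace ℝ (Fin (k + 2))) (hu : ‖u‖ = 1)
    {F : ℝ → ℝ} (hF : Continuous F) :
    ∫ w, F (inner ℝ u (w : EuclideanSpace ℝ (Fin (k + 2))))
        ∂(volume : Measure (EuclideanSpace ℝ (Fin (k + 2)))).toSphere =
      volSphere (k + 2) * ∫ α in (0 : ℝ)..Real.pi, F (Real.cos α) * Real.sin α ^ k := by
  rw [← integral_map (φ := fun w : sphere (0 : EuclideanSpace ℝ (Fin (k + 2))) 1 =>
    inner ℝ u (w : EuclideanSpace ℝ (Fin (k + 2)))) (by fun_prop)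
    hF.aestronglyMeasurable, map_inner_toSphere k u hu, integral_smul_measure,
    integral_map (by fun_prop) hF.aestronglyMeasurable,
    integral_withDensity_eq_integral_toReal_smul₀ (by fun_prop)
      (Filter.Eventually.of_forall fun _ => by simp), smul_eq_mul,
    intervalIntegral.integral_of_le Real.pi_pos.le, integral_Ioc_eq_integral_Ioo]
  refine congr_arg₂ _ rfl (setIntegral_congr_fun measurableSet_Ioo fun θ hθ => ?_)
  have := Real.sin_pos_of_pos_of_lt_pi hθ.1 hθ.2
  simp only [smul_eq_mul]
  rw [ENNReal.toReal_ofReal (by positivity), mul_comm]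

theorem volSphere_pos (k : ℕ) : 0 < volSphere (k + 2) := by
  have h : (volume : Measure (EuclideanSpace ℝ (Fin (k + 2 - 1)))).toSphere univ ≠ 0 := by
    rw [Ne, Measure.measure_univ_eq_zero]
    exact Measure.toSphere_ne_zero (E := EuclideanSpace ℝ (Fin (k + 1))) volume
  exact ENNReal.toReal_pos h (measure_ne_top _ _)

theorem gam_pos (n : ℕ) (t : ℝ) : 0 < gam n t := by
  refine intervalIntegral.intervalIntegral_pos_of_pos_on
    (Continuous.intervalIntegrable (by fun_prop) _ _) (fun α hα => ?_) Real.pi_pos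
  have := Real.sin_pos_of_pos_of_lt_pi hα.1 hα.2
  positivity

/-- Differentiation of `γ_n` under the integral sign. -/
theorem hasDerivAt_gam (n : ℕ) (t : ℝ) :
    HasDerivAt (gam n) (∫ α in (0 : ℝ)..Real.pi,
      Real.cos α * Real.exp (t * Real.cos α) * Real.sin α ^ (n - 2)) t := by
  refine (intervalIntegral.hasDerivAt_integral_of_dominated_loc_of_deriv_le
    (s := Metric.ball t 1) (bound := fun _ => Real.exp (|t| + 1)) (μ := volume)
    (F := fun t α => Real.exp (t * Real.cos α) * Real.sin α ^ (n - 2))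
    (F' := fun t α => Real.cos α * Real.exp (t * Real.cos α) * Real.sin α ^ (n - 2))
    (Metric.ball_mem_nhds t one_pos) ?_ ?_ ?_ ?_ ?_ ?_).2
  · exact Filter.Eventually.of_forall fun _ => Continuous.aestronglyMeasurable (by fun_prop)
  · exact Continuous.intervalIntegrable (by fun_prop) _ _
  · exact Continuous.aestronglyMeasurable (by fun_prop)
  · refine Filter.Eventually.of_forall fun α _ x hx => ?_
    have h1 : |x| ≤ |t| + 1 := by
      have : |x - t| < 1 := hx
      have := abs_sub_abs_le_abs_sub x t
      linarith
    have h2 : x * Real.cos α ≤ |t| + 1 := by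
      calc x * Real.cos α ≤ |x * Real.cos α| := le_abs_self _
        _ = |x| * |Real.cos α| := abs_mul _ _
        _ ≤ |x| * 1 := by gcongr; exact Real.abs_cos_le_one α
        _ ≤ _ := by linarith
    rw [norm_mul, norm_mul, norm_pow, Real.norm_eq_abs, Real.norm_eq_abs, Real.norm_eq_abs,
      abs_of_pos (Real.exp_pos _)]
    calc |Real.cos α| * Real.exp (x * Real.cos α) * |Real.sin α| ^ (n - 2)
        ≤ 1 * Real.exp (|t| + 1) * 1 := by
          gcongr
          · exact Real.abs_cos_le_one α
          · exact pow_le_one₀ (abs_nonneg _) (Real.abs_sin_le_one α)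
      _ = _ := by ring
  · exact intervalIntegrable_const
  · refine Filter.Eventually.of_forall fun α _ x _ => ?_
    have h := (((hasDerivAt_id' x).mul_const (Real.cos α)).exp).mul_const (Real.sin α ^ (n - 2))
    rwa [one_mul, mul_comm (Real.exp _)] at h

theorem exists_unit_eq_norm_smul (k : ℕ) (v : EuclideanSpace ℝ (Fin (k + 2))) :
    ∃ u : EuclideanSpace ℝ (Fin (k + 2)), ‖u‖ = 1 ∧ v = ‖v‖ • u := by
  by_cases h : v = 0
  · exact ⟨EuclideanSpace.single 0 1, by simp, by simp [h]⟩
  · refine ⟨‖v‖⁻¹ • v, ?_, ?_⟩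
    · rw [norm_smul, norm_inv, norm_norm, inv_mul_cancel₀ (norm_ne_zero_iff.mpr h)]
    · rw [smul_smul, mul_inv_cancel₀ (norm_ne_zero_iff.mpr h), one_smul]

/-- The total mass of `e^{⟨v, w⟩}` on the unit sphere. -/
theorem integral_sphere_exp (k : ℕ) (v : EuclideanSpace ℝ (Fin (k + 2))) :
    ∫ w, Real.exp (inner ℝ v (w : EuclideanSpace ℝ (Fin (k + 2))))
        ∂(volume : Measure (EuclideanSpace ℝ (Fin (k + 2)))).toSphere =
      volSphere (k + 2) * gam (k + 2) ‖v‖ := by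
  obtain ⟨u, hu, hv⟩ := exists_unit_eq_norm_smul k v
  have h := integral_sphere_inner k u hu (F := fun s => Real.exp (‖v‖ * s)) (by fun_prop)
  conv_lhs => rw [hv]
  simpa only [inner_smul_left, conj_trivial, gam, Nat.add_sub_cancel] using h

/-- The first moment of `e^{⟨v, w⟩}` on the unit sphere, in the direction of `v`. -/
theorem integral_sphere_inner_mul_exp (k : ℕ) (v : EuclideanSpace ℝ (Fin (k + 2))) :
    ∫ w, inner ℝ v (w : EuclideanSpace ℝ (Fin (k + 2))) *
        Real.exp (inner ℝ v (w : EuclideanSpace ℝ (Fin (k + 2))))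
        ∂(volume : Measure (EuclideanSpace ℝ (Fin (k + 2)))).toSphere =
      volSphere (k + 2) * (‖v‖ * deriv (gam (k + 2)) ‖v‖) := by
  by_cases h : v = 0
  · simp [h]
  have hu : ‖‖v‖⁻¹ • v‖ = 1 := by
    rw [norm_smul, norm_inv, norm_norm, inv_mul_cancel₀ (norm_ne_zero_iff.mpr h)]
  have hv : v = ‖v‖ • (‖v‖⁻¹ • v) := by
    rw [smul_smul, mul_inv_cancel₀ (norm_ne_zero_iff.mpr h), one_smul]
  have h := integral_sphere_inner k _ hu (F := fun s => ‖v‖ * s * Real.exp (‖v‖ * s))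
    (by fun_prop)
  have h2 : ∀ w : EuclideanSpace ℝ (Fin (k + 2)),
      ‖v‖ * inner ℝ (‖v‖⁻¹ • v) w = inner ℝ v w := fun w => by
    conv_rhs => rw [hv]
    rw [inner_smul_left _ _ ‖v‖]; simp
  simp only [h2] at h
  rw [h, (hasDerivAt_gam (k + 2) ‖v‖).deriv, ← intervalIntegral.integral_const_mul ‖v‖]
  simp only [Nat.add_sub_cancel, mul_assoc]

end SphereIntegrals

variable {n : ℕ} {ε : ℝ}

open scoped ContDiff ComplexConjugate

/-! ### Coordinates on `X` -/

/-- `ofReIm` as a continuous linear map. -/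
def ofReImL (n : ℕ) : EuclideanSpace ℝ (Fin n) × EuclideanSpace ℝ (Fin n) →L[ℝ]
    EuclideanSpace ℂ (Fin n) :=
  LinearMap.toContinuousLinearMap
    { toFun := fun q => ofReIm q.1 q.2
      map_add' := fun a b => by ext j; simp [ofReIm]; ring
      map_smul' := fun c a => by ext j; simp [ofReIm]; ring }

/-- `imPart` as a continuous linear map. -/
def imPartL (n : ℕ) : EuclideanSpace ℂ (Fin n) →L[ℝ] EuclideanSpace ℝ (Fin n) :=
  LinearMap.toContinuousLinearMap
    { toFun := imPart
      map_add' := fun a b => by ext j; simp [imPart]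
      map_smul' := fun c a => by ext j; simp [imPart] }

/-- `rePart` as a continuous linear map. -/
def rePartL (n : ℕ) : EuclideanSpace ℂ (Fin n) →L[ℝ] EuclideanSpace ℝ (Fin n) :=
  LinearMap.toContinuousLinearMap
    { toFun := rePart
      map_add' := fun a b => by ext j; simp [rePart]
      map_smul' := fun c a => by ext j; simp [rePart] }

theorem ofReImL_apply (q : EuclideanSpace ℝ (Fin n) × EuclideanSpace ℝ (Fin n)) :
    ofReImL n q = ofReIm q.1 q.2 := rfl

theorem continuous_ofReIm :
    Continuous fun q : EuclideanSpace ℝ (Fin n) × EuclideanSpace ℝ (Fin n) => ofReIm q.1 q.2 :=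
  (ofReImL n).continuous

theorem continuous_imPart : Continuous (imPart (n := n)) := (imPartL n).continuous

theorem rePart_ofReIm (x y : EuclideanSpace ℝ (Fin n)) : rePart (ofReIm x y) = x := by
  ext j; simp [rePart, ofReIm]

theorem ofReIm_rePart_imPart (z : EuclideanSpace ℂ (Fin n)) :
    ofReIm (rePart z) (imPart z) = z := by
  ext j
  simp only [rePart, ofReIm, imPart, mul_comm Complex.I]
  exact Complex.re_add_im _

theorem ofReIm_add (x x' y y' : EuclideanSpace ℝ (Fin n)) :
    ofReIm (x + x') (y + y') = ofReIm x y + ofReIm x' y' :=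
  (ofReImL n).map_add (x, y) (x', y')

theorem ofReIm_smul (c : ℝ) (x y : EuclideanSpace ℝ (Fin n)) :
    ofReIm (c • x) (c • y) = c • ofReIm x y :=
  (ofReImL n).map_smul c (x, y)

/-- The parametrization `(x, w) ↦ [x + i ε w]` of `X` by `ℝⁿ × S^{n-1}`. -/
def coord (n : ℕ) (ε : ℝ) [Fact (0 < ε)]
    (q : EuclideanSpace ℝ (Fin n) × sphere (0 : EuclideanSpace ℝ (Fin n)) 1) : X n ε :=
  param q.1 (q.2 : EuclideanSpace ℝ (Fin n)) (by simp)

/-- The half-open box `[0, 2π)ⁿ`. -/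
def box (n : ℕ) : Set (EuclideanSpace ℝ (Fin n)) := {x | ∀ j, x j ∈ Ico (0 : ℝ) (2 * Real.pi)}

/-- Lebesgue measure on the box times surface measure on the sphere. -/
def coordMeasure (n : ℕ) :
    Measure (EuclideanSpace ℝ (Fin n) × sphere (0 : EuclideanSpace ℝ (Fin n)) 1) :=
  ((volume : Measure (EuclideanSpace ℝ (Fin n))).restrict (box n)).prod
    (volume : Measure (EuclideanSpace ℝ (Fin n))).toSphere

theorem vol_eq [Fact (0 < ε)] :
    vol n ε = ENNReal.ofReal (ε ^ (n - 1)) • Measure.map (coord n ε) (coordMeasure n) := rfl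

theorem continuous_coord [Fact (0 < ε)] : Continuous (coord n ε) := by
  refine Continuous.subtype_mk ?_ _
  refine continuous_quotient_mk'.comp ?_
  exact continuous_ofReIm.comp (f := fun q : EuclideanSpace ℝ (Fin n) ×
    sphere (0 : EuclideanSpace ℝ (Fin n)) 1 => (q.1, ε • (q.2 : EuclideanSpace ℝ (Fin n))))
    (by fun_prop)

theorem coord_val [Fact (0 < ε)]
    (q : EuclideanSpace ℝ (Fin n) × sphere (0 : EuclideanSpace ℝ (Fin n)) 1) :
    (coord n ε q).1 = QuotientAddGroup.mk (ofReIm q.1 (ε • (q.2 : EuclideanSpace ℝ (Fin n)))) := rfl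

@[simp] theorem imM_coord [Fact (0 < ε)]
    (q : EuclideanSpace ℝ (Fin n) × sphere (0 : EuclideanSpace ℝ (Fin n)) 1) :
    imM (coord n ε q).1 = ε • (q.2 : EuclideanSpace ℝ (Fin n)) := by
  rw [coord_val, imM_mk, imPart_ofReIm]

/-- The vector `2π k`, for `k ∈ ℤⁿ`. -/
def period (k : Fin n → ℤ) : EuclideanSpace ℝ (Fin n) :=
  WithLp.toLp 2 fun j => 2 * Real.pi * (k j : ℝ)

theorem coord_add_period [Fact (0 < ε)] (x : EuclideanSpace ℝ (Fin n))
    (w : sphere (0 : EuclideanSpace ℝ (Fin n)) 1) (k : Fin n → ℤ) :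
    coord n ε (x + period k, w) = coord n ε (x, w) := by
  apply Subtype.ext
  rw [coord_val, coord_val]
  refine (QuotientAddGroup.eq).mpr ⟨-k, fun j => ?_⟩
  simp [ofReIm, period]
  ring

theorem exists_add_period_mem_box (x : EuclideanSpace ℝ (Fin n)) :
    ∃ k : Fin n → ℤ, x + period k ∈ box n := by
  have hp := Real.two_pi_pos
  refine ⟨fun j => -⌊x j / (2 * Real.pi)⌋, fun j => ?_⟩
  have h1 := Int.floor_le (x j / (2 * Real.pi))
  have h2 := Int.lt_floor_add_one (x j / (2 * Real.pi))
  rw [le_div_iff₀ hp] at h1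
  rw [div_lt_iff₀ hp] at h2
  simp only [period, PiLp.add_apply, Int.cast_neg, mem_Ico]
  constructor <;> linarith

theorem exists_coord_eq [hε : Fact (0 < ε)] (p : X n ε) : ∃ x ∈ box n, ∃ w, coord n ε (x, w) = p := by
  obtain ⟨z, hz⟩ := QuotientAddGroup.mk_surjective p.1
  have hn : ‖imPart z‖ = ε := by rw [← imM_mk, hz]; exact p.2
  obtain ⟨k, hk⟩ := exists_add_period_mem_box (rePart z)
  refine ⟨_, hk, ⟨ε⁻¹ • imPart z, ?_⟩, ?_⟩
  · rw [mem_sphere_zero_iff_norm, norm_smul, hn, norm_inv, Real.norm_of_nonneg hε.out.le,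
      inv_mul_cancel₀ hε.out.ne']
  · rw [coord_add_period]
    apply Subtype.ext
    rw [coord_val, ← hz]
    simp only
    rw [smul_smul, mul_inv_cancel₀ hε.out.ne', one_smul, ofReIm_rePart_imPart]

theorem continuous_imM : Continuous (imM (n := n)) := continuous_quot_lift _ continuous_imPart

theorem continuous_character (m : Fin n → ℤ) : Continuous (character m) :=
  continuous_quot_lift _ (by fun_prop)

theorem character_mk (m : Fin n → ℤ) (z : EuclideanSpace ℂ (Fin n)) :
    character m (QuotientAddGroup.mk z) = Complex.exp (Complex.I * ∑ j, (m j : ℂ) * z j) := rfl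

theorem continuous_val : Continuous (fun p : X n ε => (p.1 : TorusC n)) := continuous_subtype_val

/-- The characters `e^{i z_j}` embed `X` into `ℂⁿ`. -/
theorem characters_injective :
    Function.Injective fun (p : X n ε) (j : Fin n) => character (Pi.single j 1) p.1 := by
  intro p p' h
  apply Subtype.ext
  obtain ⟨z, hz⟩ := QuotientAddGroup.mk_surjective p.1
  obtain ⟨z', hz'⟩ := QuotientAddGroup.mk_surjective p'.1
  rw [← hz, ← hz']
  have h1 : ∀ j, ∃ k : ℤ, z' j = z j + 2 * Real.pi * k := fun j => by
    have h2 := congrFun h j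
    simp only [← hz, ← hz', character_mk] at h2
    obtain ⟨k, hk⟩ := Complex.exp_eq_exp_iff_exists_int.mp h2.symm
    refine ⟨k, ?_⟩
    have h3 : ∀ y : EuclideanSpace ℂ (Fin n),
        ∑ i, (((Pi.single j 1 : Fin n → ℤ) i : ℤ) : ℂ) * y i = y j := fun y => by
      rw [Finset.sum_eq_single j]
      · simp
      · intro i _ hi; simp [hi]
      · simp
    rw [h3, h3] at hk
    have hI := Complex.I_ne_zero
    apply mul_left_cancel₀ hI
    rw [hk]; ring
  choose k hk using h1
  refine (QuotientAddGroup.eq).mpr ⟨k, fun j => ?_⟩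
  simp [hk j]

theorem continuous_characters :
    Continuous fun (p : X n ε) (j : Fin n) => character (Pi.single j 1) p.1 :=
  continuous_pi fun _ => (continuous_character _).comp continuous_val

instance : T2Space (X n ε) := T2Space.of_injective_continuous characters_injective
  continuous_characters

/-- The closed box `[0, 2π]ⁿ`. -/
def closedBox (n : ℕ) : Set (EuclideanSpace ℝ (Fin n)) :=
  {x | ∀ j, x j ∈ Icc (0 : ℝ) (2 * Real.pi)}

theorem box_subset_closedBox : box n ⊆ closedBox n := fun _ hx j => Ico_subset_Icc_self (hx j)

theorem isCompact_closedBox : IsCompact (closedBox n) := by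
  have h : closedBox n = (WithLp.toLp 2) '' (univ.pi fun _ => Icc (0 : ℝ) (2 * Real.pi)) := by
    ext x
    constructor
    · intro hx
      exact ⟨fun j => x j, fun j _ => hx j, rfl⟩
    · rintro ⟨y, hy, rfl⟩ j
      exact hy j trivial
  rw [h]
  exact (isCompact_univ_pi fun _ => isCompact_Icc).image (PiLp.continuous_toLp 2 _)

theorem image_coord_closedBox [Fact (0 < ε)] : coord n ε '' (closedBox n ×ˢ univ) = univ :=
  eq_univ_of_forall fun p => by
    obtain ⟨x, hx, w, h⟩ := exists_coord_eq p
    exact ⟨(x, w), ⟨box_subset_closedBox hx, trivial⟩, h⟩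

theorem isCompact_closedBox_prod :
    IsCompact (closedBox n ×ˢ (univ : Set (sphere (0 : EuclideanSpace ℝ (Fin n)) 1))) :=
  isCompact_closedBox.prod isCompact_univ

instance [Fact (0 < ε)] : CompactSpace (X n ε) :=
  ⟨by rw [← image_coord_closedBox]; exact isCompact_closedBox_prod.image continuous_coord⟩

instance [Fact (0 < ε)] : SecondCountableTopology (X n ε) :=
  (continuous_characters.isClosedEmbedding characters_injective).isEmbedding.secondCountableTopology

/-- Continuity on `X` may be checked in coordinates: a compact part of the parameter space already
maps onto the Hausdorff space `X`. -/
theorem isQuotientMap_coord [Fact (0 < ε)] : Topology.IsQuotientMap (coord n ε) := by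
  have hc : CompactSpace
      ↥(closedBox n ×ˢ (univ : Set (sphere (0 : EuclideanSpace ℝ (Fin n)) 1))) :=
    isCompact_iff_compactSpace.mp isCompact_closedBox_prod
  have h1 : Continuous (coord n ε ∘ (Subtype.val : ↥(closedBox n ×ˢ
      (univ : Set (sphere (0 : EuclideanSpace ℝ (Fin n)) 1))) → _)) :=
    continuous_coord.comp continuous_subtype_val
  have h2 : Function.Surjective (coord n ε ∘ (Subtype.val : ↥(closedBox n ×ˢ
      (univ : Set (sphere (0 : EuclideanSpace ℝ (Fin n)) 1))) → _)) := fun p => by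
    obtain ⟨x, hx, w, h⟩ := exists_coord_eq p
    exact ⟨⟨(x, w), ⟨box_subset_closedBox hx, trivial⟩⟩, h⟩
  exact Topology.IsQuotientMap.of_comp continuous_subtype_val continuous_coord
    (h1.isClosedMap.isQuotientMap h1 h2)

/-! ### Integration over `X` -/

theorem measurableSet_box : MeasurableSet (box n) := by
  have : box n = ⋂ j, (fun x : EuclideanSpace ℝ (Fin n) => x j) ⁻¹' Ico 0 (2 * Real.pi) := by
    ext x; simp [box]
  rw [this]
  exact MeasurableSet.iInter fun j => measurableSet_Ico.preimage (by fun_prop)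

theorem volume_box : (volume : Measure (EuclideanSpace ℝ (Fin n))) (box n) =
    ENNReal.ofReal ((2 * Real.pi) ^ n) := by
  have h : box n = (WithLp.ofLp : EuclideanSpace ℝ (Fin n) → Fin n → ℝ) ⁻¹'
      (univ.pi fun _ => Ico (0 : ℝ) (2 * Real.pi)) := by
    ext x; simp [box]
  rw [h, (PiLp.volume_preserving_ofLp (Fin n)).measure_preimage
    (MeasurableSet.univ_pi fun _ => measurableSet_Ico).nullMeasurableSet, Real.volume_pi_Ico]
  simp only [sub_zero, Finset.prod_const, Finset.card_univ, Fintype.card_fin]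
  rw [ENNReal.ofReal_pow Real.two_pi_pos.le]

instance : IsFiniteMeasure ((volume : Measure (EuclideanSpace ℝ (Fin n))).restrict (box n)) :=
  ⟨by rw [Measure.restrict_apply_univ, volume_box]; exact ENNReal.ofReal_lt_top⟩

instance : IsFiniteMeasure (coordMeasure n) :=
  inferInstanceAs (IsFiniteMeasure (Measure.prod _ _))

instance [Fact (0 < ε)] : IsFiniteMeasure (vol n ε) := by
  rw [vol_eq]
  exact Measure.smul_finite _ ENNReal.ofReal_ne_top

theorem integral_vol [hε : Fact (0 < ε)] {V : Type*} [NormedAddCommGroup V] [NormedSpace ℝ V]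
    [SecondCountableTopology V]
    {f : X n ε → V} (hf : Continuous f) :
    ∫ p, f p ∂vol n ε = ε ^ (n - 1) • ∫ q, f (coord n ε q) ∂coordMeasure n := by
  rw [vol_eq, integral_smul_measure, integral_map continuous_coord.measurable.aemeasurable,
    ENNReal.toReal_ofReal (pow_nonneg hε.out.le _)]
  borelize V
  exact hf.measurable.stronglyMeasurable.aestronglyMeasurable

theorem integrable_coordMeasure {V : Type*} [NormedAddCommGroup V]
    [SecondCountableTopology V]
    {f : EuclideanSpace ℝ (Fin n) × sphere (0 : EuclideanSpace ℝ (Fin n)) 1 → V}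
    (hf : Continuous f) : Integrable f (coordMeasure n) := by
  obtain ⟨C, hC⟩ := isCompact_closedBox_prod.exists_bound_of_continuousOn hf.continuousOn
  borelize V
  refine Integrable.of_bound hf.measurable.stronglyMeasurable.aestronglyMeasurable C ?_
  have : ∀ᵐ q ∂coordMeasure n, q.1 ∈ box n :=
    Measure.quasiMeasurePreserving_fst.ae (ae_restrict_mem measurableSet_box)
  filter_upwards [this] with q hq
  exact hC q ⟨box_subset_closedBox hq, trivial⟩

theorem memLp_vol [Fact (0 < ε)] {V : Type*} [NormedAddCommGroup V]
    [SecondCountableTopology V] {f : X n ε → V} (hf : Continuous f) (p : ENNReal) :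
    MemLp f p (vol n ε) := by
  obtain ⟨C, hC⟩ := isCompact_univ.exists_bound_of_continuousOn hf.continuousOn
  borelize V
  exact MemLp.of_bound hf.measurable.stronglyMeasurable.aestronglyMeasurable C
    (Filter.Eventually.of_forall fun p => hC p trivial)

theorem box_subset_closure_interior : box n ⊆ closure (interior (box n)) := by
  have hconv : Convex ℝ (box n) := by
    have : box n = ⋂ j, (fun x : EuclideanSpace ℝ (Fin n) => x j) ⁻¹' Ico 0 (2 * Real.pi) := by
      ext x; simp [box]
    rw [this]
    refine convex_iInter fun j => ?_
    exact (convex_Ico 0 (2 * Real.pi)).is_linear_preimage ⟨fun _ _ => rfl, fun _ _ => rfl⟩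
  have hne : (interior (box n)).Nonempty := by
    refine ⟨WithLp.toLp 2 fun _ => Real.pi, mem_interior.mpr
      ⟨⋂ j, (fun x : EuclideanSpace ℝ (Fin n) => x j) ⁻¹' Ioo 0 (2 * Real.pi), ?_, ?_, ?_⟩⟩
    · intro x hx j
      exact Ioo_subset_Ico_self (mem_iInter.mp hx j)
    · exact isOpen_iInter_of_finite fun j => isOpen_Ioo.preimage (by fun_prop)
    · refine mem_iInter.mpr fun j => ?_
      have := Real.pi_pos
      simp only [mem_preimage, mem_Ioo]
      constructor <;> linarith
  rw [hconv.closure_interior_eq_closure_of_nonempty_interior hne]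
  exact subset_closure

/-- The volume of `X` charges every nonempty open set. -/
theorem eq_of_ae_eq_vol [hε : Fact (0 < ε)] {f g : X n ε → ℂ} (hf : Continuous f) (hg : Continuous g)
    (h : f =ᵐ[vol n ε] g) : f = g := by
  have h0 : ENNReal.ofReal (ε ^ (n - 1)) ≠ 0 := by
    rw [Ne, ENNReal.ofReal_eq_zero, not_le]; exact pow_pos hε.out _
  rw [vol_eq, Filter.EventuallyEq, Measure.ae_ennreal_smul_measure_iff h0] at h
  have h1 := ae_of_ae_map continuous_coord.measurable.aemeasurable h
  rw [coordMeasure, show (volume : Measure (EuclideanSpace ℝ (Fin n))).toSphere =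
    (volume : Measure (EuclideanSpace ℝ (Fin n))).toSphere.restrict univ by simp,
    Measure.prod_restrict] at h1
  have h2 := Measure.eqOn_of_ae_eq (f := f ∘ coord n ε) (g := g ∘ coord n ε) h1
    (hf.comp continuous_coord).continuousOn (hg.comp continuous_coord).continuousOn (by
      rw [interior_prod_eq, closure_prod_eq, interior_univ, closure_univ]
      exact prod_mono box_subset_closure_interior le_rfl)
  funext p
  obtain ⟨x, hx, w, rfl⟩ := exists_coord_eq p
  exact h2 (show (x, w) ∈ box n ×ˢ univ from ⟨hx, trivial⟩)

open scoped Pointwise in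
/-- The integral of a periodic function over a box is invariant under translations: every translate
of the box is a fundamental domain of `2πℤⁿ`. -/
theorem setIntegral_box_add {F : EuclideanSpace ℝ (Fin n) → ℂ}
    (hF : ∀ x k, F (x + period k) = F x) (a : EuclideanSpace ℝ (Fin n)) :
    ∫ x in box n, F (x + a) = ∫ x in box n, F x := by
  let b : Module.Basis (Fin n) ℝ (EuclideanSpace ℝ (Fin n)) :=
    (EuclideanSpace.basisFun (Fin n) ℝ).toBasis.isUnitSMul (w := fun _ => 2 * Real.pi)
      (fun _ => Real.two_pi_pos.ne'.isUnit)
  have hbr : ∀ x j, b.repr x j = (2 * Real.pi)⁻¹ * x j := fun x j => by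
    rw [Module.Basis.repr_isUnitSMul, Units.smul_def]
    simp
  have hdom : ZSpan.fundamentalDomain b = box n := by
    ext x
    have hp := Real.two_pi_pos
    simp only [ZSpan.mem_fundamentalDomain, hbr, box, mem_ofPred_eq, mem_Ico]
    refine forall_congr' fun j => and_congr ?_ ?_
    · exact ⟨fun h => by have := (mul_nonneg_iff_of_pos_left (inv_pos.mpr hp)).mp h; exact this,
        fun h => by positivity⟩
    · rw [inv_mul_lt_iff₀ hp, mul_one]
  have hfd := ZSpan.isAddFundamentalDomain' b (volume : Measure (EuclideanSpace ℝ (Fin n)))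
  rw [hdom] at hfd
  have hinv : ∀ (g : (Submodule.span ℤ (Set.range b)).toAddSubgroup) x, F (g +ᵥ x) = F x := by
    rintro ⟨g, hg⟩ x
    have : ∃ k, g = period k := by
      rw [Submodule.mem_toAddSubgroup, b.mem_span_iff_repr_mem ℤ] at hg
      choose k hk using hg
      refine ⟨k, ?_⟩
      ext j
      have h1 := hk j
      rw [hbr] at h1
      simp only [period]
      have hp := Real.two_pi_pos.ne'
      have h2 : (k j : ℝ) = (2 * Real.pi)⁻¹ * g j := by simpa using h1
      rw [h2, mul_inv_cancel_left₀ hp]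
    obtain ⟨k, rfl⟩ := this
    rw [show (⟨period k, hg⟩ : (Submodule.span ℤ (Set.range b)).toAddSubgroup) +ᵥ x =
      x + period k from add_comm _ _, hF]
  have hfd2 := hfd.vadd_of_comm a
  have hcount : Countable (Submodule.span ℤ (Set.range b)).toAddSubgroup :=
    inferInstanceAs (Countable (Submodule.span ℤ (Set.range b)))
  have h := hfd.setIntegral_eq hfd2 (f := F) hinv
  rw [h]
  have hpre : box n = (fun x => x + a) ⁻¹' (a +ᵥ box n) := by
    ext x
    rw [mem_preimage, mem_vadd_set_iff_neg_vadd_mem]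
    simp
  conv_lhs => rw [hpre]
  exact (measurePreserving_add_right volume a).setIntegral_preimage_emb
    (MeasurableEquiv.addRight a).measurableEmbedding F (a +ᵥ box n)

/-! ### Derivatives of smooth functions on `X` -/

section Derivatives

variable {V : Type*} [NormedAddCommGroup V] [NormedSpace ℝ V]

theorem imPart_rep (p : X n ε) : imPart (rep p) = imM p.1 := by
  have h : (QuotientAddGroup.mk (rep p) : TorusC n) = p.1 := Quotient.out_eq p.1
  rw [← imM_mk, h]

/-- The point of `ℂⁿ` with the given coordinates. -/
def lift (n : ℕ) (ε : ℝ)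
    (q : EuclideanSpace ℝ (Fin n) × sphere (0 : EuclideanSpace ℝ (Fin n)) 1) :
    EuclideanSpace ℂ (Fin n) :=
  ofReIm q.1 (ε • (q.2 : EuclideanSpace ℝ (Fin n)))

theorem continuous_lift : Continuous (lift n ε) :=
  continuous_ofReIm.comp (f := fun q : EuclideanSpace ℝ (Fin n) ×
    sphere (0 : EuclideanSpace ℝ (Fin n)) 1 => (q.1, ε • (q.2 : EuclideanSpace ℝ (Fin n))))
    (by fun_prop)

theorem imPart_lift (q : EuclideanSpace ℝ (Fin n) × sphere (0 : EuclideanSpace ℝ (Fin n)) 1) :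
    imPart (lift n ε q) = ε • (q.2 : EuclideanSpace ℝ (Fin n)) := imPart_ofReIm _ _

theorem imPart_lift_ne_zero [hε : Fact (0 < ε)]
    (q : EuclideanSpace ℝ (Fin n) × sphere (0 : EuclideanSpace ℝ (Fin n)) 1) :
    imPart (lift n ε q) ≠ 0 := by
  rw [imPart_lift]
  exact smul_ne_zero hε.out.ne' (ne_zero_of_mem_unit_sphere q.2)

theorem coord_surjective [Fact (0 < ε)] : Function.Surjective (coord n ε) := fun p => by
  obtain ⟨x, -, w, h⟩ := exists_coord_eq p
  exact ⟨(x, w), h⟩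

theorem ext_of_ne {W : Type*} [NormedAddCommGroup W] [Fact (0 < ε)] (f : X n ε → W) {z : EuclideanSpace ℂ (Fin n)}
    (h : imPart z ≠ 0) : ∃ w : sphere (0 : EuclideanSpace ℝ (Fin n)) 1,
      (w : EuclideanSpace ℝ (Fin n)) = ‖imPart z‖⁻¹ • imPart z ∧
        ext f z = f (coord n ε (rePart z, w)) := by
  refine ⟨⟨‖imPart z‖⁻¹ • imPart z, ?_⟩, rfl, ?_⟩
  · rw [mem_sphere_zero_iff_norm, norm_smul, norm_inv, norm_norm,
      inv_mul_cancel₀ (norm_ne_zero_iff.mpr h)]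
  · simp only [ext, h, dite_false]
    rfl

theorem ext_lift {W : Type*} [NormedAddCommGroup W] [hε : Fact (0 < ε)] (f : X n ε → W)
    (q : EuclideanSpace ℝ (Fin n) × sphere (0 : EuclideanSpace ℝ (Fin n)) 1) :
    ext f (lift n ε q) = f (coord n ε q) := by
  obtain ⟨w, hw, h⟩ := ext_of_ne f (imPart_lift_ne_zero (ε := ε) q)
  have hw' : w = q.2 := by
    apply Subtype.ext
    rw [hw, imPart_lift, norm_smul, norm_eq_of_mem_sphere, mul_one,
      Real.norm_of_nonneg hε.out.le, smul_smul, inv_mul_cancel₀ hε.out.ne', one_smul]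
  rw [h, hw']
  simp [lift, rePart_ofReIm]

theorem tder_coord [Fact (0 < ε)] (f : X n ε → V)
    (q : EuclideanSpace ℝ (Fin n) × sphere (0 : EuclideanSpace ℝ (Fin n)) 1)
    (v : EuclideanSpace ℂ (Fin n)) :
    tder f (coord n ε q) v = fderiv ℝ (ext f) (lift n ε q) v :=
  (congrFun (fderiv_ext_eq_tder f (coord n ε q) (lift n ε q) rfl) v).symm

theorem IsSmooth.contDiffAt_lift [Fact (0 < ε)] {f : X n ε → V} (hf : IsSmooth f)
    (q : EuclideanSpace ℝ (Fin n) × sphere (0 : EuclideanSpace ℝ (Fin n)) 1) :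
    ContDiffAt ℝ ∞ (ext f) (lift n ε q) := hf _ (imPart_lift_ne_zero q)

theorem IsSmooth.hasFDerivAt_lift [Fact (0 < ε)] {f : X n ε → V} (hf : IsSmooth f)
    (q : EuclideanSpace ℝ (Fin n) × sphere (0 : EuclideanSpace ℝ (Fin n)) 1) :
    HasFDerivAt (ext f) (fderiv ℝ (ext f) (lift n ε q)) (lift n ε q) :=
  ((hf.contDiffAt_lift q).differentiableAt (by simp)).hasFDerivAt

theorem IsSmooth.continuous [Fact (0 < ε)] {f : X n ε → V} (hf : IsSmooth f) : Continuous f := by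
  rw [isQuotientMap_coord.continuous_iff, continuous_iff_continuousAt]
  intro q
  have h : f ∘ coord n ε = ext f ∘ lift n ε := funext fun q => (ext_lift f q).symm
  rw [h]
  exact (hf.contDiffAt_lift q).continuousAt.comp continuous_lift.continuousAt

theorem IsSmooth.continuous_tder [Fact (0 < ε)] {f : X n ε → V} (hf : IsSmooth f)
    {v : X n ε → EuclideanSpace ℂ (Fin n)} (hv : Continuous v) :
    Continuous fun p => tder f p (v p) := by
  rw [isQuotientMap_coord.continuous_iff, continuous_iff_continuousAt]
  intro q
  have h : (fun p => tder f p (v p)) ∘ coord n ε =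
      fun q => fderiv ℝ (ext f) (lift n ε q) (v (coord n ε q)) :=
    funext fun q => tder_coord f q _
  rw [h]
  have h1 : ContinuousAt (fun q => fderiv ℝ (ext f) (lift n ε q)) q :=
    ((hf.contDiffAt_lift q).fderiv_right (m := 0) (by simp)).continuousAt.comp
      continuous_lift.continuousAt
  exact h1.clm_apply (hv.comp continuous_coord).continuousAt

/-- The retraction of `{Im z ≠ 0}` onto `{|Im z| = ε}`. -/
def retract (ε : ℝ) (z : EuclideanSpace ℂ (Fin n)) : EuclideanSpace ℂ (Fin n) :=
  ofReIm (rePart z) (ε • ‖imPart z‖⁻¹ • imPart z)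

theorem contDiffAt_retract {z : EuclideanSpace ℂ (Fin n)} (hz : imPart z ≠ 0) :
    ContDiffAt ℝ ∞ (retract (n := n) ε) z := by
  have him : ContDiffAt ℝ ∞ (imPart (n := n)) z := (imPartL n).contDiff.contDiffAt
  have hre : ContDiffAt ℝ ∞ (rePart (n := n)) z := (rePartL n).contDiff.contDiffAt
  refine (ofReImL n).contDiff.contDiffAt.comp z
    (f := fun z => (rePart z, ε • ‖imPart z‖⁻¹ • imPart z)) (hre.prodMk ?_)
  exact ((((him.norm ℝ hz).inv (norm_ne_zero_iff.mpr hz)).smul him).const_smul ε)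

theorem retract_lift [hε : Fact (0 < ε)]
    (q : EuclideanSpace ℝ (Fin n) × sphere (0 : EuclideanSpace ℝ (Fin n)) 1) :
    retract ε (lift n ε q) = lift n ε q := by
  rw [retract, imPart_lift, norm_smul, norm_eq_of_mem_sphere, mul_one,
    Real.norm_of_nonneg hε.out.le, smul_smul ε⁻¹, inv_mul_cancel₀ hε.out.ne', one_smul,
    lift, rePart_ofReIm]

/-- Tangent vectors of `{|Im z| = ε}` are fixed by the derivative of the retraction. -/
theorem hasDerivAt_retract [hε : Fact (0 < ε)]
    (q : EuclideanSpace ℝ (Fin n) × sphere (0 : EuclideanSpace ℝ (Fin n)) 1)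
    (a b : EuclideanSpace ℝ (Fin n)) (hb : inner ℝ (q.2 : EuclideanSpace ℝ (Fin n)) b = 0) :
    HasDerivAt (fun t : ℝ => retract ε (lift n ε q + t • ofReIm a b)) (ofReIm a b) 0 := by
  have h1 : ∀ t : ℝ, lift n ε q + t • ofReIm a b =
      ofReIm (q.1 + t • a) (ε • (q.2 : EuclideanSpace ℝ (Fin n)) + t • b) := fun t => by
    rw [ofReIm_add, ofReIm_smul]; rfl
  have hx : HasDerivAt (fun t : ℝ => q.1 + t • a) a 0 := by
    simpa using ((hasDerivAt_id (0 : ℝ)).smul_const a).const_add q.1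
  have hy : HasDerivAt (fun t : ℝ => ε • (q.2 : EuclideanSpace ℝ (Fin n)) + t • b) b 0 := by
    simpa using ((hasDerivAt_id (0 : ℝ)).smul_const b).const_add
      (ε • (q.2 : EuclideanSpace ℝ (Fin n)))
  have hsq := hy.norm_sq
  have hn0 : ‖ε • (q.2 : EuclideanSpace ℝ (Fin n)) + (0 : ℝ) • b‖ = ε := by
    rw [zero_smul, add_zero, norm_smul, norm_eq_of_mem_sphere, mul_one,
      Real.norm_of_nonneg hε.out.le]
  have hn : HasDerivAt (fun t : ℝ => ‖ε • (q.2 : EuclideanSpace ℝ (Fin n)) + t • b‖) 0 0 := by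
    have h := hsq.sqrt (by rw [hn0]; exact pow_ne_zero 2 hε.out.ne')
    simpa [Real.sqrt_sq, inner_smul_left, hb] using h
  have hi := (((hn.fun_inv (by rw [hn0]; exact hε.out.ne')).fun_smul hy).const_smul ε)
  have hr := (ofReImL n).hasFDerivAt.comp_hasDerivAt (0 : ℝ) (hx.prodMk hi)
  have he : (fun t : ℝ => retract ε (lift n ε q + t • ofReIm a b)) =
      (ofReImL n) ∘ fun t : ℝ => (q.1 + t • a, ε • ‖ε • (q.2 : EuclideanSpace ℝ (Fin n)) + t • b‖⁻¹ •
        (ε • (q.2 : EuclideanSpace ℝ (Fin n)) + t • b)) := by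
    funext t
    rw [h1, retract, rePart_ofReIm, imPart_ofReIm]
    rfl
  rw [he]
  refine hr.congr_deriv ?_
  rw [ofReImL_apply]
  simp only [hn0]
  simp [smul_smul, hε.out.ne']

theorem ext_eq_retract {W : Type*} [NormedAddCommGroup W] [Fact (0 < ε)] {f : X n ε → W} {g : EuclideanSpace ℂ (Fin n) → W}
    (h : ∀ q, f (coord n ε q) = g (lift n ε q)) {z : EuclideanSpace ℂ (Fin n)}
    (hz : imPart z ≠ 0) : ext f z = g (retract ε z) := by
  obtain ⟨w, hw, he⟩ := ext_of_ne f hz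
  rw [he, h, retract, lift, hw]

theorem eventually_imPart_ne_zero {z : EuclideanSpace ℂ (Fin n)} (hz : imPart z ≠ 0) :
    ∀ᶠ z' in nhds z, imPart z' ≠ 0 :=
  continuous_imPart.continuousAt.eventually_ne hz

/-- The restriction to `X` of a smooth function on `ℂⁿ` is smooth. -/
theorem isSmooth_of_lift [Fact (0 < ε)] {f : X n ε → V} {g : EuclideanSpace ℂ (Fin n) → V}
    (hg : ContDiff ℝ ∞ g) (h : ∀ q, f (coord n ε q) = g (lift n ε q)) : IsSmooth f := by
  intro z hz
  refine (hg.contDiffAt.comp z (contDiffAt_retract (ε := ε) hz)).congr_of_eventuallyEq ?_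
  filter_upwards [eventually_imPart_ne_zero hz] with z' hz'
  exact ext_eq_retract h hz'

/-- The derivative along `X` of the restriction to `X` of a smooth function on `ℂⁿ`. -/
theorem tder_of_lift [Fact (0 < ε)] {f : X n ε → V} {g : EuclideanSpace ℂ (Fin n) → V}
    (hg : ContDiff ℝ ∞ g) (h : ∀ q, f (coord n ε q) = g (lift n ε q))
    (q : EuclideanSpace ℝ (Fin n) × sphere (0 : EuclideanSpace ℝ (Fin n)) 1)
    (a b : EuclideanSpace ℝ (Fin n)) (hb : inner ℝ (q.2 : EuclideanSpace ℝ (Fin n)) b = 0) :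
    tder f (coord n ε q) (ofReIm a b) = fderiv ℝ g (lift n ε q) (ofReIm a b) := by
  have hline : HasDerivAt (fun t : ℝ => lift n ε q + t • ofReIm a b) (ofReIm a b) 0 := by
    simpa using ((hasDerivAt_id (0 : ℝ)).smul_const (ofReIm a b)).const_add (lift n ε q)
  have hf := (isSmooth_of_lift hg h).hasFDerivAt_lift q
  have h0 : lift n ε q + (0 : ℝ) • ofReIm a b = lift n ε q := by simp
  have h1 : HasDerivAt (fun t : ℝ => ext f (lift n ε q + t • ofReIm a b))
      (tder f (coord n ε q) (ofReIm a b)) 0 := by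
    rw [tder_coord]
    exact HasFDerivAt.comp_hasDerivAt_of_eq (0 : ℝ) hf hline h0.symm
  have h2 : HasDerivAt (fun t : ℝ => g (retract ε (lift n ε q + t • ofReIm a b)))
      (fderiv ℝ g (lift n ε q) (ofReIm a b)) 0 := by
    refine HasFDerivAt.comp_hasDerivAt_of_eq (0 : ℝ) (y := lift n ε q) ?_
      (hasDerivAt_retract q a b hb) ?_
    · exact (hg.differentiable (by simp) _).hasFDerivAt
    · rw [h0, retract_lift]
  refine h1.unique (h2.congr_of_eventuallyEq ?_)
  have hz : imPart (lift n ε q + (0 : ℝ) • ofReIm a b) ≠ 0 := by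
    rw [h0]; exact imPart_lift_ne_zero q
  filter_upwards [hline.continuousAt.eventually (eventually_imPart_ne_zero hz)] with t ht
  exact ext_eq_retract h ht

end Derivatives

/-! ### Integration by parts on `X` -/

theorem ext_conj_mul [Fact (0 < ε)] (f g : X n ε → ℂ) :
    ext (fun p => conj (f p) * g p) = fun z => Complex.conjCLE (ext f z) * ext g z := by
  funext z
  by_cases h : imPart z = 0 <;> simp [ext, h]

theorem IsSmooth.conj_mul [Fact (0 < ε)] {f g : X n ε → ℂ} (hf : IsSmooth f) (hg : IsSmooth g) :
    IsSmooth fun p => conj (f p) * g p := fun z hz => by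
  rw [ext_conj_mul]
  exact (Complex.conjCLE.contDiff.contDiffAt.comp z (hf z hz)).mul (hg z hz)

theorem tder_conj_mul [Fact (0 < ε)] {f g : X n ε → ℂ} (hf : IsSmooth f) (hg : IsSmooth g)
    (p : X n ε) (v : EuclideanSpace ℂ (Fin n)) :
    tder (fun p => conj (f p) * g p) p v = conj (tder f p v) * g p + conj (f p) * tder g p v := by
  obtain ⟨q, rfl⟩ := coord_surjective p
  simp only [tder_coord, ext_conj_mul, ← ext_lift]
  have h1 : HasFDerivAt (fun z => Complex.conjCLE (ext f z))
      ((Complex.conjCLE : ℂ →L[ℝ] ℂ).comp (fderiv ℝ (ext f) (lift n ε q))) (lift n ε q) :=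
    Complex.conjCLE.hasFDerivAt.comp _ (hf.hasFDerivAt_lift q)
  rw [(h1.fun_mul (hg.hasFDerivAt_lift q)).fderiv]
  simp
  ring

/-- Differentiation under the integral sign for a family of functions with constant integral. -/
theorem integral_deriv_eq_zero {α : Type*} [MeasurableSpace α] {μ : Measure α} [IsFiniteMeasure μ]
    {F F' : ℝ → α → ℂ} (hF : ∀ t, Integrable (F t) μ) (hF' : AEStronglyMeasurable (F' 0) μ)
    {C : ℝ} (hC : ∀ᵐ q ∂μ, ∀ t ∈ ball (0 : ℝ) 1, ‖F' t q‖ ≤ C)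
    (hd : ∀ t q, HasDerivAt (fun t => F t q) (F' t q) t)
    (hinv : ∀ t, ∫ q, F t q ∂μ = ∫ q, F 0 q ∂μ) : ∫ q, F' 0 q ∂μ = 0 := by
  have h := (hasDerivAt_integral_of_dominated_loc_of_deriv_le (ball_mem_nhds (0 : ℝ) one_pos)
    (Filter.Eventually.of_forall fun t => (hF t).aestronglyMeasurable) (hF 0) hF' hC
    (integrable_const C) (Filter.Eventually.of_forall fun q t _ => hd t q)).2
  simp only [hinv] at h
  exact h.unique (hasDerivAt_const _ _)

/-- The derivative of a smooth function along a volume-preserving flow has integral zero. -/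
theorem integral_tder_flow_eq_zero [Fact (0 < ε)] {H : X n ε → ℂ} (hH : IsSmooth H)
    {Φ : ℝ → EuclideanSpace ℝ (Fin n) × sphere (0 : EuclideanSpace ℝ (Fin n)) 1 →
      EuclideanSpace ℝ (Fin n) × sphere (0 : EuclideanSpace ℝ (Fin n)) 1}
    (hΦ : Continuous (Function.uncurry Φ)) (hΦ0 : ∀ q, Φ 0 q = q)
    {v : X n ε → EuclideanSpace ℂ (Fin n)} (hv : Continuous v)
    (hd : ∀ t q, HasDerivAt (fun t => lift n ε (Φ t q)) (v (coord n ε (Φ t q))) t)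
    (hinv : ∀ t, ∫ q, H (coord n ε (Φ t q)) ∂coordMeasure n =
      ∫ q, H (coord n ε q) ∂coordMeasure n) :
    ∫ p, tder H p (v p) ∂vol n ε = 0 := by
  have hcont := hH.continuous_tder hv
  have hcoord := continuous_coord (n := n) (ε := ε)
  have hHc := hH.continuous
  have hjoint : Continuous fun s : ℝ × EuclideanSpace ℝ (Fin n) ×
      sphere (0 : EuclideanSpace ℝ (Fin n)) 1 =>
        tder H (coord n ε (Φ s.1 s.2)) (v (coord n ε (Φ s.1 s.2))) :=
    hcont.comp (hcoord.comp hΦ)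
  obtain ⟨C, hC⟩ := ((isCompact_Icc (a := (-1 : ℝ)) (b := 1)).prod
    (isCompact_closedBox_prod (n := n))).exists_bound_of_continuousOn hjoint.continuousOn
  have hΦt : ∀ t, Continuous (Φ t) := fun t =>
    hΦ.comp (Continuous.prodMk continuous_const continuous_id)
  have hbox : ∀ᵐ q ∂coordMeasure n, q.1 ∈ box n :=
    Measure.quasiMeasurePreserving_fst.ae (ae_restrict_mem measurableSet_box)
  rw [integral_vol hcont]
  have h := integral_deriv_eq_zero (μ := coordMeasure n)
    (F := fun t q => H (coord n ε (Φ t q)))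
    (F' := fun t q => tder H (coord n ε (Φ t q)) (v (coord n ε (Φ t q)))) (C := C)
    (fun t => integrable_coordMeasure (hHc.comp (hcoord.comp (hΦt t))))
    (integrable_coordMeasure (hcont.comp (hcoord.comp (hΦt 0)))).aestronglyMeasurable
    (by
      filter_upwards [hbox] with q hq t ht
      refine hC (t, q) ⟨?_, box_subset_closedBox hq, trivial⟩
      rw [mem_ball_zero_iff, Real.norm_eq_abs] at ht
      exact ⟨(abs_lt.mp ht).1.le, (abs_lt.mp ht).2.le⟩)
    (fun t q => by
      have h1 := (hH.hasFDerivAt_lift (Φ t q)).comp_hasDerivAt t (hd t q)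
      rw [← tder_coord] at h1
      simpa only [Function.comp_def, ext_lift] using h1)
    (fun t => by simp only [hΦ0]; exact hinv t)
  simp only [hΦ0] at h
  rw [h, smul_zero]

/-- The flow `(x, y) ↦ (x + t κ(y), y)` preserves the volume of `X`. -/
theorem integral_tder_translation [Fact (0 < ε)] {H : X n ε → ℂ} (hH : IsSmooth H)
    {κ : EuclideanSpace ℝ (Fin n) → EuclideanSpace ℝ (Fin n)} (hκ : Continuous κ) :
    ∫ p, tder H p (ofReIm (κ (imM p.1)) 0) ∂vol n ε = 0 := by
  have hHc := hH.continuous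
  have hcoord := continuous_coord (n := n) (ε := ε)
  refine integral_tder_flow_eq_zero hH
    (Φ := fun t q => (q.1 + t • κ (ε • (q.2 : EuclideanSpace ℝ (Fin n))), q.2))
    (by unfold Function.uncurry; fun_prop) (fun q => by simp) ?_ (fun t q => ?_) (fun t => ?_)
  · exact continuous_ofReIm.comp (f := fun p : X n ε => (κ (imM p.1), 0))
      ((hκ.comp (continuous_imM.comp continuous_val)).prodMk continuous_const)
  · have hx : HasDerivAt (fun t : ℝ => (q.1 + t • κ (ε • (q.2 : EuclideanSpace ℝ (Fin n))),
        ε • (q.2 : EuclideanSpace ℝ (Fin n)))) (κ (ε • (q.2 : EuclideanSpace ℝ (Fin n))), 0) t := by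
      refine HasDerivAt.prodMk ?_ (hasDerivAt_const _ _)
      simpa using ((hasDerivAt_id t).smul_const _).const_add q.1
    rw [imM_coord]
    exact (ofReImL n).hasFDerivAt.comp_hasDerivAt t hx
  · have h1 : Continuous fun q : EuclideanSpace ℝ (Fin n) ×
        sphere (0 : EuclideanSpace ℝ (Fin n)) 1 =>
        H (coord n ε (q.1 + t • κ (ε • (q.2 : EuclideanSpace ℝ (Fin n))), q.2)) := by fun_prop
    have h2 : Continuous fun q : EuclideanSpace ℝ (Fin n) ×
        sphere (0 : EuclideanSpace ℝ (Fin n)) 1 => H (coord n ε q) := by fun_prop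
    rw [coordMeasure, integral_prod_symm _ (integrable_coordMeasure h1),
      integral_prod_symm _ (integrable_coordMeasure h2)]
    refine integral_congr_ae (Filter.Eventually.of_forall fun w => ?_)
    exact setIntegral_box_add (F := fun x => H (coord n ε (x, w)))
      (fun x k => by simp only [coord_add_period]) (t • κ (ε • (w : EuclideanSpace ℝ (Fin n))))

/-- The infinitesimal rotation in the oriented plane of `a`, `b`. -/
def rotField (a b y : EuclideanSpace ℝ (Fin n)) : EuclideanSpace ℝ (Fin n) :=
  (inner ℝ a y : ℝ) • b - (inner ℝ b y : ℝ) • a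

/-- The rotation by the angle `t` in the plane of orthonormal vectors `a`, `b`. -/
def rot (a b : EuclideanSpace ℝ (Fin n)) (t : ℝ) (y : EuclideanSpace ℝ (Fin n)) :
    EuclideanSpace ℝ (Fin n) :=
  y + ((Real.cos t - 1) * inner ℝ a y - Real.sin t * inner ℝ b y) • a +
    (Real.sin t * inner ℝ a y + (Real.cos t - 1) * inner ℝ b y) • b

theorem norm_rot {a b : EuclideanSpace ℝ (Fin n)} (ha : ‖a‖ = 1) (hb : ‖b‖ = 1)
    (hab : inner ℝ a b = 0) (t : ℝ) (y : EuclideanSpace ℝ (Fin n)) : ‖rot a b t y‖ = ‖y‖ := by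
  have hba : inner ℝ b a = 0 := by rw [real_inner_comm, hab]
  rw [← sq_eq_sq₀ (norm_nonneg _) (norm_nonneg _), ← real_inner_self_eq_norm_sq,
    ← real_inner_self_eq_norm_sq]
  simp only [rot, inner_add_left, inner_add_right, inner_smul_left, inner_smul_right, conj_trivial,
    hab, hba, real_inner_self_eq_norm_sq, ha, hb, real_inner_comm a y, real_inner_comm b y]
  linear_combination ((inner ℝ a y) ^ 2 + (inner ℝ b y) ^ 2) * Real.sin_sq_add_cos_sq t

/-- The rotation as a linear isometry. -/
def rotL {a b : EuclideanSpace ℝ (Fin n)} (ha : ‖a‖ = 1) (hb : ‖b‖ = 1)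
    (hab : inner ℝ a b = 0) (t : ℝ) : EuclideanSpace ℝ (Fin n) ≃ₗᵢ[ℝ] EuclideanSpace ℝ (Fin n) :=
  LinearIsometry.toLinearIsometryEquiv
    { toFun := rot a b t
      map_add' := fun y y' => by simp only [rot, inner_add_right]; module
      map_smul' := fun c y => by
        simp only [rot, inner_smul_right, RingHom.id_apply]; module
      norm_map' := norm_rot ha hb hab t } rfl

theorem rotL_apply {a b : EuclideanSpace ℝ (Fin n)} (ha : ‖a‖ = 1) (hb : ‖b‖ = 1)
    (hab : inner ℝ a b = 0) (t : ℝ) (y : EuclideanSpace ℝ (Fin n)) :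
    rotL ha hb hab t y = rot a b t y := rfl

theorem hasDerivAt_rot {a b : EuclideanSpace ℝ (Fin n)} (ha : ‖a‖ = 1) (hb : ‖b‖ = 1)
    (hab : inner ℝ a b = 0) (t : ℝ) (y : EuclideanSpace ℝ (Fin n)) :
    HasDerivAt (fun t => rot a b t y) (rotField a b (rot a b t y)) t := by
  have hba : inner ℝ b a = 0 := by rw [real_inner_comm, hab]
  have h1 := (((((Real.hasDerivAt_cos t).sub_const 1).mul_const (inner ℝ a y)).fun_sub
    ((Real.hasDerivAt_sin t).mul_const (inner ℝ b y))).smul_const a).const_add y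
  have h2 := ((((Real.hasDerivAt_sin t).mul_const (inner ℝ a y)).fun_add
    (((Real.hasDerivAt_cos t).sub_const 1).mul_const (inner ℝ b y))).smul_const b)
  refine (h1.fun_add h2).congr_deriv ?_
  simp only [rotField, rot, inner_add_right, inner_smul_right, hab, hba,
    real_inner_self_eq_norm_sq, ha, hb]
  module

theorem rotField_smul (a b y : EuclideanSpace ℝ (Fin n)) (c : ℝ) :
    rotField a b (c • y) = c • rotField a b y := by
  simp only [rotField, inner_smul_right]; module

theorem inner_rotField_self (a b y : EuclideanSpace ℝ (Fin n)) :
    inner ℝ y (rotField a b y) = 0 := by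
  simp only [rotField, inner_sub_right, inner_smul_right, real_inner_comm y]; ring

theorem continuous_rotField (a b : EuclideanSpace ℝ (Fin n)) : Continuous (rotField a b) := by
  unfold rotField; fun_prop

/-- The flow that rotates `y` and fixes `x` preserves the volume of `X`. -/
theorem integral_tder_rotation [NeZero n] [Fact (0 < ε)] {H : X n ε → ℂ} (hH : IsSmooth H)
    {a b : EuclideanSpace ℝ (Fin n)} (ha : ‖a‖ = 1) (hb : ‖b‖ = 1) (hab : inner ℝ a b = 0) :
    ∫ p, tder H p (ofReIm 0 (rotField a b (imM p.1))) ∂vol n ε = 0 := by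
  have hHc := hH.continuous
  have hcoord := continuous_coord (n := n) (ε := ε)
  refine integral_tder_flow_eq_zero hH
    (Φ := fun t q => (q.1, sphereMap (rotL ha hb hab t) q.2))
    (Continuous.prodMk (by fun_prop) (Continuous.subtype_mk ?_ _))
    (fun q => Prod.ext rfl (Subtype.ext ?_)) ?_ (fun t q => ?_) (fun t => ?_)
  · simp only [rotL_apply, rot]; fun_prop
  · simp [sphereMap, rotL_apply, rot]
  · exact continuous_ofReIm.comp (f := fun p : X n ε => (0, rotField a b (imM p.1)))
      (continuous_const.prodMk
        ((continuous_rotField a b).comp (continuous_imM.comp continuous_val)))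
  · have hx : HasDerivAt (fun t : ℝ => (q.1, ε • rot a b t q.2))
        (0, ε • rotField a b (rot a b t q.2)) t :=
      HasDerivAt.prodMk (hasDerivAt_const _ _) ((hasDerivAt_rot ha hb hab t _).const_smul ε)
    rw [imM_coord, rotField_smul]
    exact (ofReImL n).hasFDerivAt.comp_hasDerivAt t hx
  · have hs := continuous_sphereMap (rotL ha hb hab t)
    have h1 : Continuous fun q : EuclideanSpace ℝ (Fin n) ×
        sphere (0 : EuclideanSpace ℝ (Fin n)) 1 =>
        H (coord n ε (q.1, sphereMap (rotL ha hb hab t) q.2)) := by fun_prop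
    have h2 : Continuous fun q : EuclideanSpace ℝ (Fin n) ×
        sphere (0 : EuclideanSpace ℝ (Fin n)) 1 => H (coord n ε q) := by fun_prop
    rw [coordMeasure, integral_prod _ (integrable_coordMeasure h1),
      integral_prod _ (integrable_coordMeasure h2)]
    refine integral_congr_ae (Filter.Eventually.of_forall fun x => ?_)
    have hmp := measurePreserving_sphereMap (rotL ha hb hab t)
    have h3 : Continuous fun w : sphere (0 : EuclideanSpace ℝ (Fin n)) 1 => H (coord n ε (x, w)) := by
      fun_prop
    simp only
    conv_rhs => rw [← hmp.map_eq]
    rw [integral_map hmp.measurable.aemeasurable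
      h3.measurable.stronglyMeasurable.aestronglyMeasurable]

/-! ### Exponentials on `X` -/

/-- An integer vector as an element of Euclidean space. -/
def vec (m : Fin n → ℤ) : EuclideanSpace ℝ (Fin n) := WithLp.toLp 2 fun j => (m j : ℝ)

theorem norm_vec (m : Fin n → ℤ) : ‖vec m‖ = len m := by
  simp [EuclideanSpace.norm_eq, vec, len]

theorem inner_vec (m : Fin n → ℤ) (y : EuclideanSpace ℝ (Fin n)) :
    inner ℝ (vec m) y = ∑ j, (m j : ℝ) * y j := by
  simp [PiLp.inner_apply, vec, mul_comm]

/-- The real linear form `z ↦ i⟨m, z⟩ + ⟨ζ, Im z⟩` on `ℂⁿ`. -/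
def waveExponent (m : Fin n → ℤ) (ζ : EuclideanSpace ℝ (Fin n)) :
    EuclideanSpace ℂ (Fin n) →L[ℝ] ℂ :=
  LinearMap.toContinuousLinearMap
    { toFun := fun z => Complex.I * ∑ j, (m j : ℂ) * z j + (inner ℝ ζ (imPart z) : ℝ)
      map_add' := fun z z' => by
        rw [show imPart (z + z') = imPart z + imPart z' from (imPartL n).map_add z z']
        simp only [PiLp.add_apply, mul_add, Finset.sum_add_distrib, inner_add_right]
        push_cast; ring
      map_smul' := fun c z => by
        rw [show imPart (c • z) = c • imPart z from (imPartL n).map_smul c z]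
        simp only [PiLp.smul_apply, Complex.real_smul, inner_smul_right, RingHom.id_apply,
          Complex.ofReal_mul, mul_add, Finset.mul_sum]
        congr 1
        exact Finset.sum_congr rfl fun j _ => by ring }

theorem waveExponent_apply (m : Fin n → ℤ) (ζ : EuclideanSpace ℝ (Fin n))
    (z : EuclideanSpace ℂ (Fin n)) :
    waveExponent m ζ z = Complex.I * ∑ j, (m j : ℂ) * z j + (inner ℝ ζ (imPart z) : ℝ) := rfl

theorem waveExponent_ofReIm (m : Fin n → ℤ) (ζ a b : EuclideanSpace ℝ (Fin n)) :
    waveExponent m ζ (ofReIm a b) =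
      Complex.I * (inner ℝ (vec m) a : ℝ) + (inner ℝ (ζ - vec m) b : ℝ) := by
  rw [waveExponent_apply, imPart_ofReIm, inner_sub_left, inner_vec, inner_vec]
  simp only [ofReIm, Complex.ofReal_sub, Complex.ofReal_sum, Complex.ofReal_mul,
    Complex.ofReal_intCast, mul_add, Finset.sum_add_distrib, Finset.mul_sum]
  have h : ∀ j : Fin n, Complex.I * ((m j : ℂ) * (Complex.I * (b j : ℂ))) = -((m j : ℂ) * b j) :=
    fun j => by linear_combination (m j : ℂ) * b j * Complex.I_sq
  simp only [h, Finset.sum_neg_distrib]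
  ring

/-- The function `[z] ↦ e^{i⟨m, z⟩ + ⟨ζ, Im z⟩}` on `X`. -/
def wave (m : Fin n → ℤ) (ζ : EuclideanSpace ℝ (Fin n)) (p : X n ε) : ℂ :=
  character m p.1 * (Real.exp (inner ℝ ζ (imM p.1)) : ℂ)

theorem wave_coord [Fact (0 < ε)] (m : Fin n → ℤ) (ζ : EuclideanSpace ℝ (Fin n))
    (q : EuclideanSpace ℝ (Fin n) × sphere (0 : EuclideanSpace ℝ (Fin n)) 1) :
    wave m ζ (coord n ε q) = Complex.exp (waveExponent m ζ (lift n ε q)) := by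
  rw [wave, imM_coord, coord_val, character_mk, waveExponent_apply, imPart_lift,
    Complex.ofReal_exp, ← Complex.exp_add]
  rfl

theorem contDiff_exp_waveExponent (m : Fin n → ℤ) (ζ : EuclideanSpace ℝ (Fin n)) :
    ContDiff ℝ ∞ fun z => Complex.exp (waveExponent m ζ z) :=
  (waveExponent m ζ).contDiff.cexp

theorem isSmooth_wave [Fact (0 < ε)] (m : Fin n → ℤ) (ζ : EuclideanSpace ℝ (Fin n)) :
    IsSmooth (wave (ε := ε) m ζ) :=
  isSmooth_of_lift (contDiff_exp_waveExponent m ζ) (wave_coord m ζ)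

theorem tder_wave [hε : Fact (0 < ε)] (m : Fin n → ℤ) (ζ : EuclideanSpace ℝ (Fin n)) (p : X n ε)
    {a b : EuclideanSpace ℝ (Fin n)} (hb : inner ℝ (imM p.1) b = 0) :
    tder (wave m ζ) p (ofReIm a b) =
      (Complex.I * (inner ℝ (vec m) a : ℝ) + (inner ℝ (ζ - vec m) b : ℝ)) * wave m ζ p := by
  obtain ⟨q, rfl⟩ := coord_surjective p
  have hb' : inner ℝ (q.2 : EuclideanSpace ℝ (Fin n)) b = 0 := by
    rw [imM_coord, inner_smul_left] at hb
    exact (mul_eq_zero.mp hb).resolve_left hε.out.ne'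
  rw [tder_of_lift (contDiff_exp_waveExponent m ζ) (wave_coord m ζ) q a b hb', wave_coord,
    ((waveExponent m ζ).hasFDerivAt.cexp).fderiv, ← waveExponent_ofReIm]
  simp [mul_comm]

/-! ### The tangential Cauchy-Riemann operator on test functions -/

/-- The pairing of `∂̄_b f` with a real tangent vector field. -/
theorem sum_dbarB_mul [Fact (0 < ε)] (f : X n ε → ℂ) (p : X n ε) {k : EuclideanSpace ℝ (Fin n)}
    (hk : inner ℝ (imM p.1) k = 0) :
    ∑ j, dbarB f p j * (k j : ℂ) =
      (tder f p (ofReIm k 0) + Complex.I * tder f p (ofReIm 0 k)) / (Real.sqrt 2 : ℂ) := by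
  have h0 : ∑ j, (imM p.1 j : ℂ) * (k j : ℂ) = 0 := by
    rw [PiLp.inner_apply] at hk
    simp only [RCLike.inner_apply, conj_trivial] at hk
    rw [← Complex.ofReal_zero, ← hk]
    push_cast
    exact Finset.sum_congr rfl fun j _ => mul_comm _ _
  have h1 : tder f p (ofReIm k 0) =
      ∑ j, (k j : ℂ) * tder f p (ofReIm (EuclideanSpace.single j 1) 0) := by
    have : ofReIm k 0 = ∑ j, k j • ofReIm (EuclideanSpace.single j (1 : ℝ)) 0 := by
      ext i
      simp [ofReIm, Finset.sum_apply, apply_ite Complex.ofReal]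
    rw [this, tder, map_sum]
    exact Finset.sum_congr rfl fun j _ => by rw [map_smul, Complex.real_smul]; rfl
  have h2 : tder f p (ofReIm 0 k) =
      ∑ j, (k j : ℂ) * tder f p (ofReIm 0 (EuclideanSpace.single j 1)) := by
    have : ofReIm 0 k = ∑ j, k j • ofReIm 0 (EuclideanSpace.single j (1 : ℝ)) := by
      ext i
      simp [ofReIm, Finset.sum_apply, apply_ite Complex.ofReal, mul_comm]
    rw [this, tder, map_sum]
    exact Finset.sum_congr rfl fun j _ => by rw [map_smul, Complex.real_smul]; rfl
  simp only [dbarB, imPart_rep, sub_mul, Finset.sum_sub_distrib]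
  simp only [mul_assoc, ← Finset.mul_sum, h0, mul_zero, sub_zero]
  rw [h1, h2, Finset.mul_sum, ← Finset.sum_add_distrib, Finset.sum_div]
  exact Finset.sum_congr rfl fun j _ => by rw [dbarCoeff]; ring

/-- `∂̄_b f` vanishes at a point if it does on all real tangent vectors there. -/
theorem dbarB_eq_zero [hε : Fact (0 < ε)] {f : X n ε → ℂ} {p : X n ε}
    (h : ∀ k : EuclideanSpace ℝ (Fin n), inner ℝ (imM p.1) k = 0 →
      tder f p (ofReIm k 0) + Complex.I * tder f p (ofReIm 0 k) = 0) : dbarB f p = 0 := by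
  have hy : inner ℝ (imM p.1) (imM p.1) = ε ^ 2 := by
    rw [real_inner_self_eq_norm_sq, p.2]
  have h0 := isForm01At_dbarB f p
  rw [IsForm01At, imPart_rep] at h0
  ext i
  -- the tangential part of the `i`-th basis vector
  have hk := sum_dbarB_mul f p
    (k := EuclideanSpace.single i (1 : ℝ) - (imM p.1 i / ε ^ 2) • imM p.1) (by
      rw [inner_sub_right, inner_smul_right, hy, div_mul_cancel₀ _ (pow_ne_zero 2 hε.out.ne')]
      simp [EuclideanSpace.inner_single_right])
  rw [h _ (by
      rw [inner_sub_right, inner_smul_right, hy, div_mul_cancel₀ _ (pow_ne_zero 2 hε.out.ne')]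
      simp [EuclideanSpace.inner_single_right]), zero_div] at hk
  simp only [PiLp.sub_apply, PiLp.smul_apply, smul_eq_mul, Complex.ofReal_sub, Complex.ofReal_mul,
    mul_sub, Finset.sum_sub_distrib] at hk
  have h3 : ∑ j, dbarB f p j * (((imM p.1 i / ε ^ 2 : ℝ) : ℂ) * (imM p.1 j : ℂ)) = 0 := by
    rw [← mul_zero ((imM p.1 i / ε ^ 2 : ℝ) : ℂ), ← h0, Finset.mul_sum]
    exact Finset.sum_congr rfl fun j _ => by ring
  rw [h3, sub_zero] at hk
  simpa [Pi.single_apply, apply_ite Complex.ofReal] using hk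

theorem dbarB_wave_zero [Fact (0 < ε)] (m : Fin n → ℤ) : dbarB (wave (ε := ε) m 0) = 0 := by
  funext p
  refine dbarB_eq_zero fun k hk => ?_
  rw [tder_wave m 0 p (by simp), tder_wave m 0 p hk]
  simp only [zero_sub, inner_neg_left, inner_zero_right]
  push_cast
  ring

/-- A smooth function `f` with `∂̄_b f = 0` belongs to `H⁰_b(X)`. -/
theorem mem_Hb_of_dbarB_eq_zero [Fact (0 < ε)] {f : X n ε → ℂ} (hf : IsSmooth f)
    (h : dbarB f = 0) {u : L2 n ε} (hu : u =ᵐ[vol n ε] f) : u ∈ Hb n ε := by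
  rw [mem_Hb_iff, dbar, Submodule.mem_adjoint_iff]
  intro α w hw
  have h1 := (Submodule.mem_adjoint_iff _ _).mp hw.1 u 0
    ⟨f, hf, hu, by rw [h]; exact Lp.coeFn_zero _ _ _⟩
  rw [inner_zero_left, zero_sub, neg_eq_zero] at h1
  rw [inner_zero_right, sub_zero, ← inner_conj_symm, h1, map_zero]

/-- The coefficients of a `(0,1)`-form supported on a rotation field. -/
def testForm (m : Fin n → ℤ) (ζ a b : EuclideanSpace ℝ (Fin n)) (p : X n ε) :
    EuclideanSpace ℂ (Fin n) :=
  wave m ζ p • ofReIm (rotField a b (imM p.1)) 0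

theorem contDiff_rotField (a b : EuclideanSpace ℝ (Fin n)) : ContDiff ℝ ∞ (rotField a b) :=
  ((contDiff_const.inner ℝ contDiff_id).smul contDiff_const).sub
    ((contDiff_const.inner ℝ contDiff_id).smul contDiff_const)

theorem isSmooth_testForm [Fact (0 < ε)] (m : Fin n → ℤ) (ζ a b : EuclideanSpace ℝ (Fin n)) :
    IsSmooth (testForm (ε := ε) m ζ a b) := by
  refine isSmooth_of_lift (g := fun z => Complex.exp (waveExponent m ζ z) •
    ofReIm (rotField a b (imPart z)) 0) ?_ fun q => ?_
  · refine (contDiff_exp_waveExponent m ζ).smul ((ofReImL n).contDiff.comp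
      (f := fun z => (rotField a b (imPart z), 0)) (ContDiff.prodMk ?_ contDiff_const))
    exact (contDiff_rotField a b).comp (imPartL n).contDiff
  · rw [testForm, wave_coord, imM_coord, imPart_lift]

theorem isForm01At_testForm [Fact (0 < ε)] (m : Fin n → ℤ) (ζ a b : EuclideanSpace ℝ (Fin n))
    (p : X n ε) : IsForm01At p (testForm m ζ a b p) := by
  have h := inner_rotField_self a b (imM p.1)
  rw [PiLp.inner_apply] at h
  simp only [RCLike.inner_apply, conj_trivial] at h
  rw [IsForm01At, imPart_rep]
  simp only [testForm, PiLp.smul_apply, ofReIm, smul_eq_mul, mul_assoc, ← Finset.mul_sum]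
  simp only [PiLp.zero_apply, Complex.ofReal_zero, mul_zero, add_zero]
  rw [show ∑ j, (rotField a b (imM p.1) j : ℂ) * (imM p.1 j : ℂ) = ((0 : ℝ) : ℂ) by
    rw [← h]; push_cast; rfl]
  simp

/-- The formal adjoint of `∂̄_b` on `testForm`. -/
def testFun (m : Fin n → ℤ) (ζ a b : EuclideanSpace ℝ (Fin n)) (p : X n ε) : ℂ :=
  (Complex.I / (Real.sqrt 2 : ℂ) *
    (inner ℝ (ζ - (2 : ℝ) • vec m) (rotField a b (imM p.1)) : ℝ)) * wave m ζ p

theorem isSmooth_testFun [Fact (0 < ε)] (m : Fin n → ℤ) (ζ a b : EuclideanSpace ℝ (Fin n)) :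
    IsSmooth (testFun (ε := ε) m ζ a b) := by
  refine isSmooth_of_lift (g := fun z => (Complex.I / (Real.sqrt 2 : ℂ) *
    (inner ℝ (ζ - (2 : ℝ) • vec m) (rotField a b (imPart z)) : ℝ)) *
      Complex.exp (waveExponent m ζ z)) ?_ fun q => ?_
  · have h : ContDiff ℝ ∞ fun z : EuclideanSpace ℂ (Fin n) =>
        (inner ℝ (ζ - (2 : ℝ) • vec m) (rotField a b (imPart z)) : ℝ) :=
      contDiff_const.inner ℝ ((contDiff_rotField a b).comp (imPartL n).contDiff)
    exact ContDiff.mul (contDiff_const.mul (Complex.ofRealCLM.contDiff.comp h))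
      (contDiff_exp_waveExponent m ζ)
  · rw [testFun, wave_coord, imM_coord, imPart_lift]

/-- Integration by parts: the tangent vector field `K + iJK` preserves the volume for a rotation
field `K`, and its conjugate multiplies an exponential by a function of `Im z`. -/
theorem integral_dbarB_testForm [NeZero n] [Fact (0 < ε)] {f : X n ε → ℂ} (hf : IsSmooth f)
    (m : Fin n → ℤ) (ζ : EuclideanSpace ℝ (Fin n))
    {a b : EuclideanSpace ℝ (Fin n)} (ha : ‖a‖ = 1) (hb : ‖b‖ = 1) (hab : inner ℝ a b = 0) :
    ∫ p, inner ℂ (dbarB f p) (testForm m ζ a b p) ∂vol n ε =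
      ∫ p, inner ℂ (f p) (testFun m ζ a b p) ∂vol n ε := by
  have hw := isSmooth_wave (ε := ε) m ζ
  have hH := hf.conj_mul hw
  have hx := integral_tder_translation hH (continuous_rotField a b)
  have hy := integral_tder_rotation hH ha hb hab
  have hkc : Continuous fun p : X n ε => rotField a b (imM p.1) :=
    (continuous_rotField a b).comp (continuous_imM.comp continuous_val)
  have hvx : Continuous fun p : X n ε => ofReIm (rotField a b (imM p.1)) 0 :=
    continuous_ofReIm.comp (f := fun p : X n ε => (rotField a b (imM p.1), 0))
      (hkc.prodMk continuous_const)
  have hvy : Continuous fun p : X n ε => ofReIm 0 (rotField a b (imM p.1)) :=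
    continuous_ofReIm.comp (f := fun p : X n ε => (0, rotField a b (imM p.1)))
      (continuous_const.prodMk hkc)
  have hix := (memLp_vol (hH.continuous_tder hvx) 1).integrable le_rfl
  have hiy := (memLp_vol (hH.continuous_tder hvy) 1).integrable le_rfl
  have hpt : ∀ p, inner ℂ (dbarB f p) (testForm m ζ a b p) - inner ℂ (f p) (testFun m ζ a b p) =
      (tder (fun p => conj (f p) * wave m ζ p) p (ofReIm (rotField a b (imM p.1)) 0) -
        Complex.I * tder (fun p => conj (f p) * wave m ζ p) p
          (ofReIm 0 (rotField a b (imM p.1)))) / (Real.sqrt 2 : ℂ) := fun p => by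
    have hk := inner_rotField_self a b (imM p.1)
    have h1 : inner ℂ (dbarB f p) (testForm m ζ a b p) =
        conj (∑ j, dbarB f p j * (rotField a b (imM p.1) j : ℂ)) * wave m ζ p := by
      rw [PiLp.inner_apply, map_sum, Finset.sum_mul]
      refine Finset.sum_congr rfl fun j _ => ?_
      simp only [testForm, RCLike.inner_apply, PiLp.smul_apply, smul_eq_mul, ofReIm,
        PiLp.zero_apply, Complex.ofReal_zero, mul_zero, add_zero, map_mul, Complex.conj_ofReal]
      ring
    rw [h1, sum_dbarB_mul f p hk, tder_conj_mul hf hw, tder_conj_mul hf hw,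
      tder_wave m ζ p (by simp), tder_wave m ζ p hk, RCLike.inner_apply, testFun]
    simp only [map_div₀, map_add, map_mul, Complex.conj_ofReal, Complex.conj_I, inner_zero_right,
      inner_sub_left, inner_smul_left, conj_trivial]
    push_cast
    ring
  have hfc := hf.continuous
  have hφ := (isSmooth_testForm (ε := ε) m ζ a b).continuous
  have hψ := (isSmooth_testFun (ε := ε) m ζ a b).continuous
  have hiψ : Integrable (fun p => inner ℂ (f p) (testFun m ζ a b p)) (vol n ε) :=
    (memLp_vol (hfc.inner hψ) 1).integrable le_rfl
  have hsum : Integrable (fun p => (tder (fun p => conj (f p) * wave m ζ p) p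
      (ofReIm (rotField a b (imM p.1)) 0) -
        Complex.I * tder (fun p => conj (f p) * wave m ζ p) p
          (ofReIm 0 (rotField a b (imM p.1)))) / (Real.sqrt 2 : ℂ)) (vol n ε) :=
    (hix.sub (hiy.const_mul Complex.I)).div_const _
  have h2 : ∀ p, inner ℂ (dbarB f p) (testForm m ζ a b p) =
      (tder (fun p => conj (f p) * wave m ζ p) p (ofReIm (rotField a b (imM p.1)) 0) -
        Complex.I * tder (fun p => conj (f p) * wave m ζ p) p
          (ofReIm 0 (rotField a b (imM p.1)))) / (Real.sqrt 2 : ℂ) +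
      inner ℂ (f p) (testFun m ζ a b p) := fun p => by rw [← hpt]; ring
  simp only [h2]
  rw [integral_add hsum hiψ, integral_div, integral_sub hix (hiy.const_mul _), hx,
    integral_const_mul, hy]
  simp

/-- A square integrable CR function is orthogonal to the formal adjoints of the test forms. -/
theorem integral_conj_mul_testFun [NeZero n] [Fact (0 < ε)] {u : L2 n ε} (hu : u ∈ Hb n ε)
    (m : Fin n → ℤ) (ζ : EuclideanSpace ℝ (Fin n))
    {a b : EuclideanSpace ℝ (Fin n)} (ha : ‖a‖ = 1) (hb : ‖b‖ = 1) (hab : inner ℝ a b = 0) :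
    ∫ p, conj (u p) * testFun m ζ a b p ∂vol n ε = 0 := by
  have hφs := isSmooth_testForm (ε := ε) m ζ a b
  have hψs := isSmooth_testFun (ε := ε) m ζ a b
  have hφm := memLp_vol hφs.continuous 2
  have hψm := memLp_vol hψs.continuous 2
  let φ : L2Form n ε := ⟨hφm.toLp _, by
    change ∀ᵐ p ∂vol n ε, IsForm01At p _
    filter_upwards [hφm.coeFn_toLp] with p hp
    rw [hp]; exact isForm01At_testForm m ζ a b p⟩
  let ψ : L2 n ε := hψm.toLp _
  have hφe : (φ.1 : X n ε → EuclideanSpace ℂ (Fin n)) =ᵐ[vol n ε] testForm m ζ a b :=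
    hφm.coeFn_toLp
  have hψe : (ψ : X n ε → ℂ) =ᵐ[vol n ε] testFun m ζ a b := hψm.coeFn_toLp
  have hmem : (φ, ψ) ∈ dbarFormalAdjoint n ε := by
    refine ⟨(Submodule.mem_adjoint_iff _ _).mpr ?_,
      ⟨⟨_, hφs, isForm01At_testForm m ζ a b, hφe⟩, ⟨_, hψs, hψe⟩⟩⟩
    rintro v β ⟨f, hf, hvf, hβf⟩
    rw [Submodule.coe_inner, L2.inner_def, L2.inner_def, sub_eq_zero]
    refine (integral_congr_ae ?_).trans ((integral_dbarB_testForm hf m ζ ha hb hab).trans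
      (integral_congr_ae ?_))
    · filter_upwards [hβf, hφe] with p h1 h2
      rw [h1, h2]
    · filter_upwards [hvf, hψe] with p h1 h2
      rw [show v p = f p from h1, h2]
  have h := (Submodule.mem_adjoint_iff _ _).mp ((mem_Hb_iff u).mp hu) φ ψ hmem
  rw [inner_zero_right, sub_zero, ← inner_conj_symm, map_eq_zero, L2.inner_def] at h
  rw [← h]
  refine integral_congr_ae ?_
  filter_upwards [hψe] with p hp
  rw [hp, RCLike.inner_apply, mul_comm]

/-! ### Completeness of the exponentials in `H⁰_b(X)` -/

theorem continuous_imM_val : Continuous fun p : X n ε => imM p.1 := continuous_imM.comp continuous_val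

theorem continuous_wave_joint (m : Fin n → ℤ) :
    Continuous fun s : EuclideanSpace ℝ (Fin n) × X n ε => wave m s.1 s.2 := by
  have h1 := (continuous_character m).comp ((continuous_val (ε := ε)).comp
    (continuous_snd (X := EuclideanSpace ℝ (Fin n))))
  have h2 := (continuous_imM_val (n := n) (ε := ε)).comp
    (continuous_snd (X := EuclideanSpace ℝ (Fin n)))
  exact h1.mul (Complex.continuous_ofReal.comp (Real.continuous_exp.comp (continuous_fst.inner h2)))

theorem wave_add (m m' : Fin n → ℤ) (ζ ζ' : EuclideanSpace ℝ (Fin n)) (p : X n ε) :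
    wave (m + m') (ζ + ζ') p = wave m ζ p * wave m' ζ' p := by
  obtain ⟨z, hz⟩ := QuotientAddGroup.mk_surjective p.1
  simp only [wave, ← hz, character_mk, inner_add_left, Real.exp_add, Pi.add_apply, Int.cast_add,
    add_mul, Finset.sum_add_distrib, mul_add, Complex.exp_add, Complex.ofReal_mul]
  ring

theorem wave_add_zero (m : Fin n → ℤ) (ζ ζ' : EuclideanSpace ℝ (Fin n)) (p : X n ε) :
    wave m (ζ + ζ') p = wave m ζ p * (Real.exp (inner ℝ ζ' (imM p.1)) : ℂ) := by
  simp only [wave, inner_add_left, Real.exp_add, Complex.ofReal_mul, mul_assoc]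

theorem conj_wave [Fact (0 < ε)] (m : Fin n → ℤ) (ζ : EuclideanSpace ℝ (Fin n)) (p : X n ε) :
    conj (wave m ζ p) = wave (-m) (ζ - (2 : ℝ) • vec m) p := by
  obtain ⟨q, rfl⟩ := coord_surjective p
  rw [wave_coord, wave_coord, ← Complex.exp_conj, lift, waveExponent_ofReIm, waveExponent_ofReIm]
  have hv : vec (-m) = -vec m := by ext j; simp [vec]
  rw [hv, show ζ - (2 : ℝ) • vec m - -vec m = ζ - vec m by module]
  simp [inner_neg_left]

theorem integrable_conj_mul [Fact (0 < ε)] (u : L2 n ε) {g : X n ε → ℂ} (hg : Continuous g) :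
    Integrable (fun p => conj (u p) * g p) (vol n ε) := by
  refine (L2.integrable_inner (𝕜 := ℂ) u ((memLp_vol hg 2).toLp g)).congr ?_
  filter_upwards [(memLp_vol hg 2).coeFn_toLp] with p hp
  rw [hp, RCLike.inner_apply, mul_comm]

theorem integrable_L2 [Fact (0 < ε)] (u : L2 n ε) : Integrable u (vol n ε) :=
  (Lp.memLp u).integrable (by norm_num)

/-- The exponential transform of the `m`-th Fourier coefficient of `u`, centred so that for CR
functions it is radial. -/
def transform [Fact (0 < ε)] (u : L2 n ε) (m : Fin n → ℤ) (ξ : EuclideanSpace ℝ (Fin n)) : ℂ :=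
  ∫ p, conj (u p) * wave m ((2 : ℝ) • vec m + ξ) p ∂vol n ε

/-- The derivative of the transform at `r a` in the direction of `b ⟂ a` vanishes for CR
functions. -/
theorem integral_conj_mul_wave_moment [NeZero n] [Fact (0 < ε)] {u : L2 n ε} (hu : u ∈ Hb n ε)
    (m : Fin n → ℤ) (r : ℝ) {a b : EuclideanSpace ℝ (Fin n)} (ha : ‖a‖ = 1) (hb : ‖b‖ = 1)
    (hab : inner ℝ a b = 0) :
    ∫ p, conj (u p) * (((r * inner ℝ b (imM p.1) : ℝ) : ℂ) *
      wave m ((2 : ℝ) • vec m + r • a) p) ∂vol n ε = 0 := by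
  have h := integral_conj_mul_testFun hu m ((2 : ℝ) • vec m + r • a) ha hb hab
  have h2 : (Real.sqrt 2 : ℂ) ≠ 0 := by
    exact_mod_cast (Real.sqrt_pos.mpr two_pos).ne'
  have hpt : ∀ p : X n ε, conj (u p) * testFun m ((2 : ℝ) • vec m + r • a) a b p =
      -(Complex.I / (Real.sqrt 2 : ℂ)) * (conj (u p) * (((r * inner ℝ b (imM p.1) : ℝ) : ℂ) *
        wave m ((2 : ℝ) • vec m + r • a) p)) := fun p => by
    rw [testFun, add_sub_cancel_left]
    simp only [rotField, inner_sub_right, inner_smul_left, inner_smul_right, hab,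
      real_inner_self_eq_norm_sq, ha, conj_trivial]
    push_cast
    ring
  simp only [hpt, integral_const_mul] at h
  exact (mul_eq_zero.mp h).resolve_left
    (neg_ne_zero.mpr (div_ne_zero Complex.I_ne_zero h2))

/-- The transform of a CR function is constant on circles around the origin, its derivative along
a circle being the integral of `integral_conj_mul_wave_moment`. -/
theorem transform_circle [NeZero n] [Fact (0 < ε)] {u : L2 n ε} (hu : u ∈ Hb n ε)
    (m : Fin n → ℤ) (r : ℝ) {a b : EuclideanSpace ℝ (Fin n)} (ha : ‖a‖ = 1) (hb : ‖b‖ = 1)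
    (hab : inner ℝ a b = 0) (θ : ℝ) :
    transform u m (r • (Real.cos θ • a + Real.sin θ • b)) = transform u m (r • a) := by
  have hba : inner ℝ b a = 0 := by rw [real_inner_comm, hab]
  set A : ℝ → EuclideanSpace ℝ (Fin n) := fun θ => Real.cos θ • a + Real.sin θ • b with hA
  set B : ℝ → EuclideanSpace ℝ (Fin n) := fun θ => (-Real.sin θ) • a + Real.cos θ • b with hB
  have hA1 : ∀ θ, ‖A θ‖ = 1 := fun θ => by
    have h : ‖A θ‖ ^ 2 = 1 := by
      rw [← real_inner_self_eq_norm_sq]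
      simp only [hA, inner_add_left, inner_add_right, inner_smul_left, inner_smul_right,
        conj_trivial, hab, hba, real_inner_self_eq_norm_sq, ha, hb]
      linear_combination Real.sin_sq_add_cos_sq θ
    exact (pow_eq_one_iff_of_nonneg (norm_nonneg _) two_ne_zero).mp h
  have hB1 : ∀ θ, ‖B θ‖ = 1 := fun θ => by
    have h : ‖B θ‖ ^ 2 = 1 := by
      rw [← real_inner_self_eq_norm_sq]
      simp only [hB, inner_add_left, inner_add_right, inner_smul_left, inner_smul_right,
        conj_trivial, hab, hba, real_inner_self_eq_norm_sq, ha, hb]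
      linear_combination Real.sin_sq_add_cos_sq θ
    exact (pow_eq_one_iff_of_nonneg (norm_nonneg _) two_ne_zero).mp h
  have hAB : ∀ θ, inner ℝ (A θ) (B θ) = 0 := fun θ => by
    simp only [hA, hB, inner_add_left, inner_add_right, inner_smul_left, inner_smul_right,
      conj_trivial, hab, hba, real_inner_self_eq_norm_sq, ha, hb]
    ring
  have hAd : ∀ θ, HasDerivAt A (B θ) θ := fun θ =>
    ((Real.hasDerivAt_cos θ).smul_const a).add ((Real.hasDerivAt_sin θ).smul_const b)
  have hAc : Continuous A := by fun_prop
  have hBc : Continuous B := by fun_prop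
  have hyc := continuous_imM_val (n := n) (ε := ε)
  have hwj := continuous_wave_joint (ε := ε) m
  have hjoint : Continuous fun s : ℝ × X n ε => ((r * inner ℝ (B s.1) (imM s.2.1) : ℝ) : ℂ) *
      wave m ((2 : ℝ) • vec m + r • A s.1) s.2 := by
    refine Continuous.mul (Complex.continuous_ofReal.comp (continuous_const.mul
      ((hBc.comp continuous_fst).inner (hyc.comp continuous_snd)))) ?_
    exact hwj.comp (f := fun s : ℝ × X n ε => ((2 : ℝ) • vec m + r • A s.1, s.2)) (by fun_prop)
  have hwd : ∀ θ (p : X n ε), HasDerivAt (fun θ => wave m ((2 : ℝ) • vec m + r • A θ) p)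
      (((r * inner ℝ (B θ) (imM p.1) : ℝ) : ℂ) * wave m ((2 : ℝ) • vec m + r • A θ) p) θ := by
    intro θ p
    have h1 : HasDerivAt (fun θ => inner ℝ ((2 : ℝ) • vec m + r • A θ) (imM p.1))
        (r * inner ℝ (B θ) (imM p.1)) θ := by
      have h := (((hAd θ).const_smul r).const_add ((2 : ℝ) • vec m)).inner ℝ
        (hasDerivAt_const θ (imM p.1))
      refine h.congr_deriv ?_
      simp [inner_smul_left]
    refine ((h1.exp.ofReal_comp).const_mul (character m p.1)).congr_deriv ?_
    rw [wave]; push_cast; ring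
  have hderiv : ∀ θ, HasDerivAt (fun θ => transform u m (r • A θ)) 0 θ := by
    intro θ
    obtain ⟨C, hC⟩ := ((isCompact_closedBall θ 1).prod
      (isCompact_univ (X := X n ε))).exists_bound_of_continuousOn hjoint.continuousOn
    have h := (hasDerivAt_integral_of_dominated_loc_of_deriv_le (μ := vol n ε)
      (F := fun θ p => conj (u p) * wave m ((2 : ℝ) • vec m + r • A θ) p)
      (F' := fun θ p => conj (u p) * (((r * inner ℝ (B θ) (imM p.1) : ℝ) : ℂ) *
        wave m ((2 : ℝ) • vec m + r • A θ) p)) (bound := fun p => ‖u p‖ * C)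
      (ball_mem_nhds θ one_pos)
      (Filter.Eventually.of_forall fun θ =>
        (integrable_conj_mul u (isSmooth_wave m _).continuous).aestronglyMeasurable)
      (integrable_conj_mul u (isSmooth_wave m _).continuous)
      (integrable_conj_mul u (hjoint.comp (f := fun p => (θ, p)) (by fun_prop))).aestronglyMeasurable
      (Filter.Eventually.of_forall fun p θ' hθ' => by
        rw [norm_mul, RCLike.norm_conj]
        exact mul_le_mul_of_nonneg_left (hC (θ', p) ⟨ball_subset_closedBall hθ', trivial⟩)
          (norm_nonneg _))
      ((integrable_L2 u).norm.mul_const C)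
      (Filter.Eventually.of_forall fun p θ' _ => (hwd θ' p).const_mul _)).2
    rwa [integral_conj_mul_wave_moment hu m r (hA1 θ) (hB1 θ) (hAB θ)] at h
  have h := is_const_of_deriv_eq_zero (fun θ => (hderiv θ).differentiableAt)
    (fun θ => (hderiv θ).deriv) θ 0
  simpa [hA] using h

/-- Two unit vectors lie on a common great circle. -/
theorem exists_great_circle (k : ℕ) (a a' : EuclideanSpace ℝ (Fin (k + 2))) (ha : ‖a‖ = 1)
    (ha' : ‖a'‖ = 1) : ∃ (b : EuclideanSpace ℝ (Fin (k + 2))) (θ : ℝ), ‖b‖ = 1 ∧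
      inner ℝ a b = 0 ∧ a' = Real.cos θ • a + Real.sin θ • b := by
  set c : ℝ := inner ℝ a a' with hc
  set d := a' - c • a with hd
  have hdsq : ‖d‖ ^ 2 = 1 - c ^ 2 := by
    rw [← real_inner_self_eq_norm_sq, hd]
    simp only [inner_sub_left, inner_sub_right, inner_smul_left, inner_smul_right, conj_trivial,
      real_inner_self_eq_norm_sq, ha, ha', ← hc, real_inner_comm a a']
    ring
  have hc1 : |c| ≤ 1 := by
    have := abs_real_inner_le_norm a a'
    rwa [ha, ha', one_mul] at this
  have hcos : Real.cos (Real.arccos c) = c := Real.cos_arccos (abs_le.mp hc1).1 (abs_le.mp hc1).2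
  have hsin : Real.sin (Real.arccos c) = ‖d‖ := by
    rw [Real.sin_arccos, ← hdsq, Real.sqrt_sq (norm_nonneg _)]
  by_cases h0 : d = 0
  -- for `a' = ±a` any unit vector orthogonal to `a` will do
  · obtain ⟨L, hL⟩ := exists_isometry_coord_eq_inner (k + 1) a ha
    refine ⟨L.symm (EuclideanSpace.single 1 1), Real.arccos c, by simp, ?_, ?_⟩
    · rw [← hL]; simp
    · rw [hcos, hsin, h0, norm_zero, zero_smul, add_zero]
      exact sub_eq_zero.mp h0
  · have hn : ‖d‖ ≠ 0 := norm_ne_zero_iff.mpr h0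
    refine ⟨‖d‖⁻¹ • d, Real.arccos c, ?_, ?_, ?_⟩
    · rw [norm_smul, norm_inv, norm_norm, inv_mul_cancel₀ hn]
    · rw [inner_smul_right, hd, inner_sub_right, inner_smul_right, real_inner_self_eq_norm_sq, ha,
        ← hc]
      ring
    · rw [hcos, hsin, smul_smul, mul_inv_cancel₀ hn, one_smul, hd]; module

variable {k : ℕ}

/-- The transform of a CR function is radial; averaging it over a sphere determines it by its
value at the origin. -/
theorem transform_average [hε : Fact (0 < ε)] {u : L2 (k + 2) ε} (hu : u ∈ Hb (k + 2) ε)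
    (m : Fin (k + 2) → ℤ) {r : ℝ} (hr : 0 ≤ r) {a : EuclideanSpace ℝ (Fin (k + 2))}
    (ha : ‖a‖ = 1) :
    ((volume : Measure (EuclideanSpace ℝ (Fin (k + 2)))).toSphere.real univ : ℂ) *
        transform u m (r • a) =
      ((volSphere (k + 2) * gam (k + 2) (r * ε) : ℝ) : ℂ) * transform u m 0 := by
  have hconst : ∀ η : sphere (0 : EuclideanSpace ℝ (Fin (k + 2))) 1,
      transform u m (r • (η : EuclideanSpace ℝ (Fin (k + 2)))) = transform u m (r • a) := fun η => by
    obtain ⟨b, θ, hb, hab, h⟩ := exists_great_circle k a η ha (norm_eq_of_mem_sphere η)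
    rw [h, transform_circle hu m r ha hb hab θ]
  have h1 : ∫ η : sphere (0 : EuclideanSpace ℝ (Fin (k + 2))) 1,
      transform u m (r • (η : EuclideanSpace ℝ (Fin (k + 2))))
        ∂(volume : Measure (EuclideanSpace ℝ (Fin (k + 2)))).toSphere =
      ((volume : Measure (EuclideanSpace ℝ (Fin (k + 2)))).toSphere.real univ : ℂ) *
        transform u m (r • a) := by
    simp only [hconst, integral_const, Complex.real_smul]
  rw [← h1]
  have hwj := continuous_wave_joint (ε := ε) m
  have hcont : Continuous fun s : sphere (0 : EuclideanSpace ℝ (Fin (k + 2))) 1 × X (k + 2) ε =>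
      wave m ((2 : ℝ) • vec m + r • (s.1 : EuclideanSpace ℝ (Fin (k + 2)))) s.2 :=
    hwj.comp (f := fun s : sphere (0 : EuclideanSpace ℝ (Fin (k + 2))) 1 × X (k + 2) ε =>
      ((2 : ℝ) • vec m + r • (s.1 : EuclideanSpace ℝ (Fin (k + 2))), s.2)) (by fun_prop)
  obtain ⟨C, hC⟩ := isCompact_univ.exists_bound_of_continuousOn hcont.continuousOn
  have hint : Integrable (Function.uncurry
      fun (η : sphere (0 : EuclideanSpace ℝ (Fin (k + 2))) 1) (p : X (k + 2) ε) =>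
        conj (u p) * wave m ((2 : ℝ) • vec m + r • (η : EuclideanSpace ℝ (Fin (k + 2)))) p)
      ((volume : Measure (EuclideanSpace ℝ (Fin (k + 2)))).toSphere.prod (vol (k + 2) ε)) := by
    have hui : Integrable (fun p => conj (u p)) (vol (k + 2) ε) := by
      simpa using integrable_conj_mul u (g := fun _ => 1) continuous_const
    refine (Integrable.comp_snd hui _).mul_bdd
      (c := C) hcont.measurable.stronglyMeasurable.aestronglyMeasurable
      (Filter.Eventually.of_forall fun s => hC s trivial)
  simp only [transform]
  rw [integral_integral_swap hint, ← integral_const_mul]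
  refine integral_congr_ae (Filter.Eventually.of_forall fun p => ?_)
  have h2 : ∀ η : sphere (0 : EuclideanSpace ℝ (Fin (k + 2))) 1,
      conj (u p) * wave m ((2 : ℝ) • vec m + r • (η : EuclideanSpace ℝ (Fin (k + 2)))) p =
        (conj (u p) * wave m ((2 : ℝ) • vec m + 0) p) *
          ((Real.exp (inner ℝ (r • imM p.1) (η : EuclideanSpace ℝ (Fin (k + 2)))) : ℝ) : ℂ) := by
    intro η
    rw [wave_add_zero, add_zero, inner_smul_left, inner_smul_left,
      real_inner_comm (imM p.1)]
    ring
  simp only [h2]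
  rw [integral_const_mul, integral_complex_ofReal, integral_sphere_exp, norm_smul, p.2,
    Real.norm_of_nonneg hr]
  ring

/-- A CR function orthogonal to all `e^{i⟨m, z⟩}` is orthogonal to all exponentials on `X`. -/
theorem integral_conj_mul_wave_eq_zero [hε : Fact (0 < ε)] {u : L2 (k + 2) ε}
    (hu : u ∈ Hb (k + 2) ε)
    (h : ∀ m : Fin (k + 2) → ℤ, ∫ p, conj (u p) * wave m 0 p ∂vol (k + 2) ε = 0)
    (m : Fin (k + 2) → ℤ) (ζ : EuclideanSpace ℝ (Fin (k + 2))) :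
    ∫ p, conj (u p) * wave m ζ p ∂vol (k + 2) ε = 0 := by
  have hS : ((volume : Measure (EuclideanSpace ℝ (Fin (k + 2)))).toSphere.real univ : ℂ) ≠ 0 := by
    have := volSphere_pos (k + 1)
    exact_mod_cast this.ne'
  have h0 : transform u m 0 = 0 := by
    obtain ⟨a, ha, he⟩ := exists_unit_eq_norm_smul k (-((2 : ℝ) • vec m))
    have h1 := transform_average hu m (norm_nonneg (-((2 : ℝ) • vec m))) ha
    rw [← he, transform, add_neg_cancel, h m, mul_zero] at h1
    refine (mul_eq_zero.mp h1.symm).resolve_left ?_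
    exact_mod_cast (mul_pos (volSphere_pos k) (gam_pos _ _)).ne'
  obtain ⟨a, ha, he⟩ := exists_unit_eq_norm_smul k (ζ - (2 : ℝ) • vec m)
  have h1 := transform_average hu m (norm_nonneg (ζ - (2 : ℝ) • vec m)) ha
  rw [← he, h0, mul_zero, transform, add_sub_cancel] at h1
  exact (mul_eq_zero.mp h1).resolve_left hS

/-- The exponentials on `X` as continuous functions. -/
def waveC (n : ℕ) (ε : ℝ) [Fact (0 < ε)] (m : Fin n → ℤ) (ζ : EuclideanSpace ℝ (Fin n)) :
    C(X n ε, ℂ) := ⟨wave m ζ, (isSmooth_wave m ζ).continuous⟩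

/-- The multiplicative monoid of exponentials. -/
def waveMonoid (n : ℕ) (ε : ℝ) [Fact (0 < ε)] : Submonoid C(X n ε, ℂ) where
  carrier := range fun s : (Fin n → ℤ) × EuclideanSpace ℝ (Fin n) => waveC n ε s.1 s.2
  one_mem' := ⟨(0, 0), by
    ext p
    obtain ⟨z, hz⟩ := QuotientAddGroup.mk_surjective p.1
    simp [waveC, wave, ← hz, character_mk]⟩
  mul_mem' := by
    rintro _ _ ⟨s, rfl⟩ ⟨s', rfl⟩
    exact ⟨(s.1 + s'.1, s.2 + s'.2), by ext p; exact wave_add _ _ _ _ p⟩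

theorem star_waveC [Fact (0 < ε)] (m : Fin n → ℤ) (ζ : EuclideanSpace ℝ (Fin n)) :
    star (waveC n ε m ζ) = waveC n ε (-m) (ζ - (2 : ℝ) • vec m) := by
  ext p; exact conj_wave m ζ p

/-- The star algebra spanned by the exponentials. -/
def waveAlgebra (n : ℕ) (ε : ℝ) [Fact (0 < ε)] : StarSubalgebra ℂ C(X n ε, ℂ) :=
  { Algebra.adjoin ℂ (waveMonoid n ε : Set C(X n ε, ℂ)) with
    star_mem' := fun {f} hf => by
      change f ∈ Algebra.adjoin ℂ _ at hf
      change star f ∈ Algebra.adjoin ℂ _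
      induction hf using Algebra.adjoin_induction with
      | mem f hf =>
        obtain ⟨s, rfl⟩ := hf
        exact Algebra.subset_adjoin ⟨(-s.1, s.2 - (2 : ℝ) • vec s.1), (star_waveC s.1 s.2).symm⟩
      | algebraMap c =>
        rw [← algebraMap_star_comm]
        exact Subalgebra.algebraMap_mem _ _
      | add f g _ _ hf hg => rw [star_add]; exact add_mem hf hg
      | mul f g _ _ hf hg => rw [star_mul]; exact mul_mem hg hf }

theorem waveAlgebra_closure [Fact (0 < ε)] : (waveAlgebra n ε).topologicalClosure = ⊤ := by
  refine ContinuousMap.starSubalgebra_topologicalClosure_eq_top_of_separatesPoints _ ?_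
  intro p p' hpp
  obtain ⟨j, hj⟩ := Function.ne_iff.mp (fun h => hpp (characters_injective h))
  refine ⟨_, ⟨waveC n ε (Pi.single j 1) 0, Algebra.subset_adjoin ⟨(_, _), rfl⟩, rfl⟩, ?_⟩
  simpa [waveC, wave] using hj

/-- The exponentials span a dense subspace of `L²(X)`. -/
theorem eq_zero_of_integral_conj_mul_wave [Fact (0 < ε)] {u : L2 n ε}
    (h : ∀ m ζ, ∫ p, conj (u p) * wave m ζ p ∂vol n ε = 0) : u = 0 := by
  have hin : ∀ g : C(X n ε, ℂ), inner ℂ u (ContinuousMap.toLp 2 (vol n ε) ℂ g) =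
      ∫ p, conj (u p) * g p ∂vol n ε := fun g => by
    rw [L2.inner_def]
    refine integral_congr_ae ?_
    filter_upwards [ContinuousMap.coeFn_toLp (p := 2) (𝕜 := ℂ) (vol n ε) g] with p hp
    rw [hp, RCLike.inner_apply, mul_comm]
  let ℓ : C(X n ε, ℂ) →L[ℂ] ℂ := (innerSL ℂ u).comp (ContinuousMap.toLp 2 (vol n ε) ℂ)
  have hker : ∀ g ∈ waveAlgebra n ε, ℓ g = 0 := by
    intro g hg
    change g ∈ Subalgebra.toSubmodule (Algebra.adjoin ℂ _) at hg
    rw [Algebra.adjoin_eq_span, Submonoid.closure_eq] at hg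
    have hle : Submodule.span ℂ (waveMonoid n ε : Set C(X n ε, ℂ)) ≤
        LinearMap.ker (ℓ : C(X n ε, ℂ) →ₗ[ℂ] ℂ) := by
      rw [Submodule.span_le]
      rintro _ ⟨s, rfl⟩
      exact (hin _).trans (h s.1 s.2)
    exact hle hg
  have hall : ∀ g, ℓ g = 0 := by
    intro g
    have hg : g ∈ closure (waveAlgebra n ε : Set C(X n ε, ℂ)) := by
      rw [← StarSubalgebra.topologicalClosure_coe, waveAlgebra_closure]
      trivial
    exact (isClosed_singleton.preimage ℓ.continuous).closure_subset_iff.mpr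
      (fun g hg => hker g hg) hg
  refine (ContinuousMap.toLp_denseRange ℂ (vol n ε) ℂ (p := 2) (by norm_num)).eq_zero_of_inner_left
    ℂ hall

/-! ### Orthonormality and the Toeplitz operator -/

/-- Distinct Fourier modes in `Re z` are orthogonal. -/
theorem integral_wave_mul_eq_zero [Fact (0 < ε)] {m : Fin n → ℤ} (hm : m ≠ 0)
    {g : EuclideanSpace ℝ (Fin n) → ℂ} (hg : Continuous g) :
    ∫ p : X n ε, wave m 0 p * g (imM p.1) ∂vol n ε = 0 := by
  have hw := (isSmooth_wave (ε := ε) m 0).continuous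
  have hc : Continuous fun p : X n ε => wave m 0 p * g (imM p.1) :=
    hw.mul (hg.comp continuous_imM_val)
  obtain ⟨j, hj⟩ := Function.ne_iff.mp hm
  have hj' : (m j : ℝ) ≠ 0 := by exact_mod_cast hj
  -- the translation by `a` changes the sign of the integrand
  set a : EuclideanSpace ℝ (Fin n) := EuclideanSpace.single j (Real.pi / m j) with ha
  have hma : inner ℝ (vec m) a = Real.pi := by
    rw [ha, EuclideanSpace.inner_single_right]
    simp [vec, div_mul_cancel₀ _ hj']
  have hshift : ∀ x w, wave m 0 (coord n ε (x + a, w)) = -wave m 0 (coord n ε (x, w)) := by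
    intro x w
    rw [wave_coord, wave_coord, show lift n ε (x + a, w) = lift n ε (x, w) + ofReIm a 0 by
      simp only [lift]; rw [← ofReIm_add, add_zero], map_add, Complex.exp_add,
      waveExponent_ofReIm, hma, inner_zero_right, Complex.ofReal_zero, add_zero,
      mul_comm Complex.I, Complex.exp_pi_mul_I, mul_neg_one]
  have hi := integrable_coordMeasure (hc.comp continuous_coord)
  rw [integral_vol hc]
  refine smul_eq_zero_of_right _ ((integral_prod_symm _ hi).trans
    (integral_eq_zero_of_ae (Filter.Eventually.of_forall fun w => ?_)))
  have h := setIntegral_box_add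
    (F := fun x => wave m 0 (coord n ε (x, w)) * g (imM (coord n ε (x, w)).1))
    (fun x k => by simp only [coord_add_period]) a
  simp only [hshift, imM_coord, neg_mul, integral_neg] at h
  simp only [Function.comp_apply, imM_coord, Pi.zero_apply]
  exact self_eq_neg.mp h.symm

/-- Integration of functions of `Im z`. -/
theorem integral_imM [hε : Fact (0 < ε)] {g : EuclideanSpace ℝ (Fin n) → ℝ} (hg : Continuous g) :
    ∫ p : X n ε, g (imM p.1) ∂vol n ε = ε ^ (n - 1) * ((2 * Real.pi) ^ n *
      ∫ w : sphere (0 : EuclideanSpace ℝ (Fin n)) 1, g (ε • (w : EuclideanSpace ℝ (Fin n)))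
        ∂(volume : Measure (EuclideanSpace ℝ (Fin n))).toSphere) := by
  have hc : Continuous fun p : X n ε => g (imM p.1) := hg.comp continuous_imM_val
  rw [integral_vol hc, smul_eq_mul]
  simp only [imM_coord]
  rw [coordMeasure, integral_fun_snd (fun w : sphere (0 : EuclideanSpace ℝ (Fin n)) 1 =>
    g (ε • (w : EuclideanSpace ℝ (Fin n)))), measureReal_restrict_apply_univ, Measure.real,
    volume_box, ENNReal.toReal_ofReal (by positivity), smul_eq_mul]

theorem conj_wave_mul_wave [Fact (0 < ε)] (l m : Fin n → ℤ) (p : X n ε) :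
    conj (wave l 0 p) * wave m 0 p =
      wave (m - l) 0 p * ((Real.exp (inner ℝ (-(2 : ℝ) • vec l) (imM p.1)) : ℝ) : ℂ) := by
  rw [conj_wave, ← wave_add, ← wave_add_zero]
  congr 1
  · abel
  · module

theorem wave_zero_zero [Fact (0 < ε)] (p : X n ε) : wave (0 : Fin n → ℤ) 0 p = 1 := by
  obtain ⟨z, hz⟩ := QuotientAddGroup.mk_surjective p.1
  simp [wave, ← hz, character_mk]

/-- The normalizing constant of `s_m`. -/
def normConst (n : ℕ) (ε : ℝ) (m : Fin n → ℤ) : ℝ :=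
  (2 * Real.pi) ^ ((n : ℝ) / 2) * Real.sqrt (ε ^ (n - 1) * gam n (2 * ε * len m) * volSphere n)

theorem sFun_eq (m : Fin n → ℤ) (p : X n ε) :
    sFun n ε m p = ((normConst n ε m : ℝ) : ℂ)⁻¹ * wave m 0 p := by
  rw [sFun, wave, inner_zero_left, Real.exp_zero, Complex.ofReal_one, mul_one, normConst,
    div_eq_inv_mul]

theorem sFun_eq_smul (m : Fin n → ℤ) :
    (sFun n ε m : X n ε → ℂ) = ((normConst n ε m : ℝ) : ℂ)⁻¹ • wave m 0 :=
  funext fun p => sFun_eq m p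

theorem isSmooth_sFun [Fact (0 < ε)] (m : Fin n → ℤ) : IsSmooth (sFun n ε m) := by
  rw [sFun_eq_smul]; exact (isSmooth_wave m 0).smul _

theorem dbarB_sFun [Fact (0 < ε)] (m : Fin n → ℤ) : dbarB (sFun n ε m) = 0 := by
  rw [sFun_eq_smul, dbarB_smul _ (isSmooth_wave m 0), dbarB_wave_zero, smul_zero]

theorem fieldT_sFun [Fact (0 < ε)] (m : Fin n → ℤ) (p : X n ε) :
    fieldT (sFun n ε m) p = Complex.I * (inner ℝ (vec m) (imM p.1) : ℝ) * sFun n ε m p := by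
  rw [fieldT, imPart_rep, sFun_eq, sFun_eq_smul, tder_smul _ (isSmooth_wave m 0),
    tder_wave m 0 p (by simp)]
  simp only [inner_zero_right, Complex.ofReal_zero, add_zero, smul_eq_mul]
  ring

theorem integral_conj_sFun_mul_of_ne [Fact (0 < ε)] {l m : Fin n → ℤ} (h : l ≠ m)
    {g : EuclideanSpace ℝ (Fin n) → ℝ} (hg : Continuous g) :
    ∫ p : X n ε, conj (sFun n ε l p) * ((g (imM p.1) : ℂ) * sFun n ε m p) ∂vol n ε = 0 := by
  have hpt : ∀ p : X n ε, conj (sFun n ε l p) * ((g (imM p.1) : ℂ) * sFun n ε m p) =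
      (conj ((normConst n ε l : ℝ) : ℂ)⁻¹ * ((normConst n ε m : ℝ) : ℂ)⁻¹) *
        (wave (m - l) 0 p * ((Real.exp (inner ℝ (-(2 : ℝ) • vec l) (imM p.1)) : ℝ) *
          (g (imM p.1) : ℂ))) := fun p => by
    rw [sFun_eq, sFun_eq, ← mul_assoc (wave (m - l) 0 p), ← conj_wave_mul_wave, map_mul]
    ring
  simp only [hpt]
  rw [integral_const_mul, integral_wave_mul_eq_zero (sub_ne_zero.mpr h.symm)
    (g := fun y => (Real.exp (inner ℝ (-(2 : ℝ) • vec l) y) : ℝ) * (g y : ℂ)) (by fun_prop),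
    mul_zero]

theorem normConst_sq [hε : Fact (0 < ε)] (m : Fin (k + 2) → ℤ) :
    normConst (k + 2) ε m ^ 2 = (2 * Real.pi) ^ (k + 2) *
      (ε ^ (k + 1) * gam (k + 2) (2 * ε * len m) * volSphere (k + 2)) := by
  have h1 : 0 ≤ ε ^ (k + 2 - 1) * gam (k + 2) (2 * ε * len m) * volSphere (k + 2) :=
    mul_nonneg (mul_nonneg (pow_nonneg hε.out.le _) (gam_pos _ _).le) (volSphere_pos k).le
  rw [normConst, mul_pow, Real.sq_sqrt h1, ← Real.rpow_natCast, ← Real.rpow_mul (by positivity)]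
  congr 1
  rw [← Real.rpow_natCast]
  congr 1
  push_cast; ring

theorem normConst_sq_pos [hε : Fact (0 < ε)] (m : Fin (k + 2) → ℤ) :
    0 < normConst (k + 2) ε m ^ 2 := by
  rw [normConst_sq]
  have h1 := gam_pos (k + 2) (2 * ε * len m)
  have h2 := volSphere_pos k
  have h3 := hε.out
  positivity

theorem integral_conj_sFun_mul_self [hε : Fact (0 < ε)] (m : Fin (k + 2) → ℤ)
    {g : EuclideanSpace ℝ (Fin (k + 2)) → ℝ} (hg : Continuous g) :
    ∫ p : X (k + 2) ε, conj (sFun (k + 2) ε m p) * ((g (imM p.1) : ℂ) * sFun (k + 2) ε m p)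
        ∂vol (k + 2) ε =
      (((volSphere (k + 2) * gam (k + 2) (2 * ε * len m))⁻¹ *
        ∫ w : sphere (0 : EuclideanSpace ℝ (Fin (k + 2))) 1,
          g (ε • (w : EuclideanSpace ℝ (Fin (k + 2)))) *
            Real.exp (inner ℝ (-(2 * ε) • vec m) (w : EuclideanSpace ℝ (Fin (k + 2))))
          ∂(volume : Measure (EuclideanSpace ℝ (Fin (k + 2)))).toSphere : ℝ) : ℂ) := by
  have hpt : ∀ p : X (k + 2) ε,
      conj (sFun (k + 2) ε m p) * ((g (imM p.1) : ℂ) * sFun (k + 2) ε m p) =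
      (((normConst (k + 2) ε m ^ 2)⁻¹ * (g (imM p.1) *
        Real.exp (inner ℝ (-(2 : ℝ) • vec m) (imM p.1))) : ℝ) : ℂ) := fun p => by
    have h := conj_wave_mul_wave m m p
    rw [sub_self, wave_zero_zero, one_mul] at h
    rw [sFun_eq, map_mul, map_inv₀, Complex.conj_ofReal]
    push_cast
    rw [Complex.ofReal_exp] at h
    rw [← h]
    ring
  simp only [hpt]
  rw [integral_complex_ofReal, integral_const_mul, integral_imM
    (g := fun y => g y * Real.exp (inner ℝ (-(2 : ℝ) • vec m) y)) (by fun_prop), normConst_sq]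
  have hin : ∀ w : EuclideanSpace ℝ (Fin (k + 2)),
      inner ℝ (-(2 : ℝ) • vec m) (ε • w) = inner ℝ (-(2 * ε) • vec m) w := fun w => by
    simp only [inner_smul_left, inner_smul_right, conj_trivial]; ring
  simp only [hin]
  have h3 := hε.out.ne'
  have h4 := Real.two_pi_pos.ne'
  congr 1
  rw [show k + 2 - 1 = k + 1 from rfl]
  field_simp

theorem norm_neg_two_eps_vec [hε : Fact (0 < ε)] (m : Fin n → ℤ) :
    ‖-(2 * ε) • vec m‖ = 2 * ε * len m := by
  rw [norm_smul, norm_neg, Real.norm_of_nonneg (by linarith [hε.out]), norm_vec]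

theorem integral_conj_sFun_mul_sFun_self [hε : Fact (0 < ε)] (m : Fin (k + 2) → ℤ) :
    ∫ p : X (k + 2) ε, conj (sFun (k + 2) ε m p) * sFun (k + 2) ε m p ∂vol (k + 2) ε = 1 := by
  have h := integral_conj_sFun_mul_self (ε := ε) m (g := fun _ => 1) continuous_const
  simp only [Complex.ofReal_one, one_mul] at h
  rw [h, integral_sphere_exp, norm_neg_two_eps_vec, inv_mul_cancel₀
    (mul_pos (volSphere_pos k) (gam_pos _ _)).ne', Complex.ofReal_one]

/-- The eigenvalue of the Toeplitz operator on `s_m`. -/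
def eigenvalue (n : ℕ) (ε : ℝ) (m : Fin n → ℤ) : ℝ :=
  len m * deriv (gam n) (2 * ε * len m) / gam n (2 * ε * len m)

theorem integral_conj_sFun_mul_moment [hε : Fact (0 < ε)] (m : Fin (k + 2) → ℤ) :
    ∫ p : X (k + 2) ε, conj (sFun (k + 2) ε m p) *
        (((-ε⁻¹ * inner ℝ (vec m) (imM p.1) : ℝ) : ℂ) * sFun (k + 2) ε m p) ∂vol (k + 2) ε =
      (eigenvalue (k + 2) ε m : ℂ) := by
  have h3 := hε.out.ne'
  rw [integral_conj_sFun_mul_self (ε := ε) m (g := fun y => -ε⁻¹ * inner ℝ (vec m) y)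
    (by fun_prop)]
  have hpt : ∀ w : EuclideanSpace ℝ (Fin (k + 2)), -ε⁻¹ * inner ℝ (vec m) (ε • w) *
      Real.exp (inner ℝ (-(2 * ε) • vec m) w) =
      (2 * ε)⁻¹ * (inner ℝ (-(2 * ε) • vec m) w * Real.exp (inner ℝ (-(2 * ε) • vec m) w)) :=
    fun w => by
      rw [inner_smul_left _ _ (-(2 * ε)), inner_smul_right]
      simp only [conj_trivial]
      field_simp
  simp only [hpt]
  rw [integral_const_mul, integral_sphere_inner_mul_exp, norm_neg_two_eps_vec, eigenvalue]
  have h1 := (gam_pos (k + 2) (2 * ε * len m)).ne'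
  have h2 := (volSphere_pos k).ne'
  congr 1
  field_simp

/-- The function `s_m` as an element of `L²(X)`. -/
def sL2 (n : ℕ) (ε : ℝ) [Fact (0 < ε)] (m : Fin n → ℤ) : L2 n ε :=
  (memLp_vol (isSmooth_sFun m).continuous 2).toLp (sFun n ε m)

theorem sL2_ae [Fact (0 < ε)] (m : Fin n → ℤ) : sL2 n ε m =ᵐ[vol n ε] sFun n ε m :=
  MemLp.coeFn_toLp _

theorem sL2_mem_Hb [Fact (0 < ε)] (m : Fin n → ℤ) : sL2 n ε m ∈ Hb n ε :=
  mem_Hb_of_dbarB_eq_zero (isSmooth_sFun m) (dbarB_sFun m) (sL2_ae m)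

theorem inner_sL2 [Fact (0 < ε)] (m : Fin n → ℤ) {u : L2 n ε} {f : X n ε → ℂ}
    (hu : u =ᵐ[vol n ε] f) : inner ℂ (sL2 n ε m) u = ∫ p, conj (sFun n ε m p) * f p ∂vol n ε := by
  rw [L2.inner_def]
  refine integral_congr_ae ?_
  filter_upwards [sL2_ae m, hu] with p h1 h2
  rw [h1, h2, RCLike.inner_apply, mul_comm]

theorem orthonormal_sL2 [Fact (0 < ε)] : Orthonormal ℂ (sL2 (k + 2) ε) := by
  rw [orthonormal_iff_ite]
  intro l m
  rw [inner_sL2 l (sL2_ae m)]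
  split_ifs with h
  · rw [h, integral_conj_sFun_mul_sFun_self]
  · simpa using integral_conj_sFun_mul_of_ne h (g := fun _ => 1) continuous_const

theorem eq_zero_of_inner_sL2 [Fact (0 < ε)] {u : L2 (k + 2) ε} (hu : u ∈ Hb (k + 2) ε)
    (h : ∀ m, inner ℂ (sL2 (k + 2) ε m) u = 0) : u = 0 := by
  refine eq_zero_of_integral_conj_mul_wave (integral_conj_mul_wave_eq_zero hu fun m => ?_)
  have h1 := h m
  rw [← inner_conj_symm, map_eq_zero, L2.inner_def] at h1
  have h2 : ∫ p, inner ℂ (u p) (sL2 (k + 2) ε m p) ∂vol (k + 2) ε =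
      ((normConst (k + 2) ε m : ℝ) : ℂ)⁻¹ * ∫ p, conj (u p) * wave m 0 p ∂vol (k + 2) ε := by
    rw [← integral_const_mul]
    refine integral_congr_ae ?_
    filter_upwards [sL2_ae (ε := ε) m] with p hp
    rw [hp, RCLike.inner_apply, sFun_eq]
    ring
  rw [h2] at h1
  refine (mul_eq_zero.mp h1).resolve_left (inv_ne_zero ?_)
  have h3 := normConst_sq_pos (ε := ε) m
  exact_mod_cast (pow_ne_zero_iff two_ne_zero).mp h3.ne'

/-- The function `s_m` as an element of `H⁰_b(X)`. -/
def sHb (n : ℕ) (ε : ℝ) [Fact (0 < ε)] (m : Fin n → ℤ) : Hb n ε := ⟨sL2 n ε m, sL2_mem_Hb m⟩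

theorem orthonormal_sHb [Fact (0 < ε)] : Orthonormal ℂ (sHb (k + 2) ε) :=
  orthonormal_iff_ite.mpr (orthonormal_iff_ite.mp (orthonormal_sL2 (k := k) (ε := ε)))

theorem span_sHb_orthogonal [Fact (0 < ε)] :
    (Submodule.span ℂ (range (sHb (k + 2) ε)))ᗮ = ⊥ := by
  rw [Submodule.eq_bot_iff]
  intro u hu
  apply Subtype.ext
  refine eq_zero_of_inner_sL2 u.2 fun m => ?_
  exact (Submodule.mem_orthogonal _ _).mp hu _ (Submodule.subset_span ⟨m, rfl⟩)

/-- The Hilbert basis `(s_m)` of `H⁰_b(X)`. -/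
def sBasis (k : ℕ) (ε : ℝ) [Fact (0 < ε)] : HilbertBasis (Fin (k + 2) → ℤ) ℂ (Hb (k + 2) ε) :=
  HilbertBasis.mkOfOrthogonalEqBot orthonormal_sHb span_sHb_orthogonal

theorem coe_sBasis [Fact (0 < ε)] (m : Fin (k + 2) → ℤ) :
    ((sBasis k ε m : Hb (k + 2) ε) : L2 (k + 2) ε) = sL2 (k + 2) ε m :=
  congrArg Subtype.val (congrFun (HilbertBasis.coe_mkOfOrthogonalEqBot _ _) m)

theorem szego_sL2 [Fact (0 < ε)] (m : Fin n → ℤ) : szego n ε (sL2 n ε m) = sL2 n ε m :=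
  Submodule.starProjection_eq_self_iff.mpr (sL2_mem_Hb m)

theorem szego_eq_smul_sL2 [Fact (0 < ε)] {g : L2 (k + 2) ε} {m : Fin (k + 2) → ℤ} {c : ℂ}
    (h : ∀ l, inner ℂ (sL2 (k + 2) ε l) g = if l = m then c else 0) :
    szego (k + 2) ε g = c • sL2 (k + 2) ε m := by
  rw [← sub_eq_zero]
  refine eq_zero_of_inner_sL2 (Submodule.sub_mem _ (Submodule.starProjection_apply_mem _ _)
    (Submodule.smul_mem _ _ (sL2_mem_Hb m))) fun l => ?_
  rw [inner_sub_right, inner_smul_right, szego, ← Submodule.inner_starProjection_left_eq_right,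
    ← szego, szego_sL2, h, orthonormal_iff_ite.mp orthonormal_sL2 l m]
  split_ifs <;> simp

/-- The operator `Π (i/ε) T` on `s_m`. -/
theorem szego_smul_fieldT [hε : Fact (0 < ε)] (m : Fin (k + 2) → ℤ) {v : L2 (k + 2) ε}
    (hv : v =ᵐ[vol (k + 2) ε] fieldT (sFun (k + 2) ε m)) :
    szego (k + 2) ε ((Complex.I / (ε : ℂ)) • v) =
      (eigenvalue (k + 2) ε m : ℂ) • sL2 (k + 2) ε m := by
  refine szego_eq_smul_sL2 fun l => ?_
  have hg : ((Complex.I / (ε : ℂ)) • v : L2 (k + 2) ε) =ᵐ[vol (k + 2) ε] fun p =>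
      ((-ε⁻¹ * inner ℝ (vec m) (imM p.1) : ℝ) : ℂ) * sFun (k + 2) ε m p := by
    filter_upwards [Lp.coeFn_smul (Complex.I / (ε : ℂ)) v, hv] with p h1 h2
    rw [h1, Pi.smul_apply, h2, fieldT_sFun, smul_eq_mul]
    push_cast
    linear_combination (ε : ℂ)⁻¹ * (inner ℝ (vec m) (imM p.1) : ℝ) * sFun (k + 2) ε m p *
      Complex.I_sq
  rw [inner_sL2 l hg]
  split_ifs with h
  · rw [h, integral_conj_sFun_mul_moment]
  · exact integral_conj_sFun_mul_of_ne h (g := fun y => -ε⁻¹ * inner ℝ (vec m) y) (by fun_prop)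

theorem mem_graphA_sL2_iff [hε : Fact (0 < ε)] (m : Fin (k + 2) → ℤ) (w : L2 (k + 2) ε) :
    (sL2 (k + 2) ε m, w) ∈ graphA (k + 2) ε ↔
      w = (eigenvalue (k + 2) ε m : ℂ) • sL2 (k + 2) ε m := by
  constructor
  · rintro ⟨v, ⟨f, hf, hsf, hvf⟩, hw⟩
    simp only [szego_sL2] at hsf hvf hw
    -- a smooth representative of `s_m` is equal to `s_m` everywhere
    have hfs : f = sFun (k + 2) ε m := eq_of_ae_eq_vol hf.continuous (isSmooth_sFun m).continuous
      (hsf.symm.trans (sL2_ae m))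
    rw [hfs] at hvf
    rw [hw, szego_smul_fieldT m hvf]
  · intro hw
    have hT : fieldT (sFun (k + 2) ε m) = fun p =>
        Complex.I * (inner ℝ (vec m) (imM p.1) : ℝ) * sFun (k + 2) ε m p :=
      funext fun p => fieldT_sFun m p
    have hTc : Continuous (fieldT (sFun (k + 2) ε m)) := by
      rw [hT]
      exact (continuous_const.mul (Complex.continuous_ofReal.comp
        (continuous_const.inner continuous_imM_val))).mul (isSmooth_sFun m).continuous
    have hTm := (memLp_vol hTc 2).coeFn_toLp
    refine ⟨(memLp_vol hTc 2).toLp _, ⟨_, isSmooth_sFun m, ?_, hTm⟩, ?_⟩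
    · simp only [szego_sL2]; exact sL2_ae m
    · rw [szego_smul_fieldT m hTm]; exact hw

end GrauertTube

end

theorem mainTheorem8 (n : ℕ) (hn : 2 ≤ n) (ε : ℝ) [Fact (0 < ε)] :
    ∃ s : HilbertBasis (Fin n → ℤ) ℂ (GrauertTube.Hb n ε),
      (∀ m : Fin n → ℤ,
        ((s m : GrauertTube.L2 n ε) : GrauertTube.X n ε → ℂ)
          =ᵐ[GrauertTube.vol n ε] GrauertTube.sFun n ε m) ∧
      ∀ (m : Fin n → ℤ) (w : GrauertTube.L2 n ε),
        ((s m : GrauertTube.L2 n ε), w) ∈ GrauertTube.graphA n ε ↔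
          w = ((GrauertTube.len m * deriv (GrauertTube.gam n) (2 * ε * GrauertTube.len m) /
            GrauertTube.gam n (2 * ε * GrauertTube.len m) : ℝ) : ℂ) •
              (s m : GrauertTube.L2 n ε) := by
  obtain ⟨k, rfl⟩ : ∃ k, n = k + 2 := ⟨n - 2, by omega⟩
  refine ⟨GrauertTube.sBasis k ε, fun m => ?_, fun m w => ?_⟩
  · rw [GrauertTube.coe_sBasis]
    exact GrauertTube.sL2_ae m
  · rw [GrauertTube.coe_sBasis]
    exact GrauertTube.mem_graphA_sL2_iff m w
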